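/- Let $W:\mathbb R\times\mathbb R\to\mathbb R$, $(u,t)\mapsto W(u,t)$, be a $C^2$ function that vanishes outside a semi-strip $\Pi=\{|u|\le U,\ t\le T\}$ and whose second derivative $W''_{uu}$ is bounded (for instance $W(u,t)=V(u,e^t)$, where $V(u,r)$ is the profile of a $C^2$ compactly supported potential $V(u,x)$, $x\in\mathbb R^2$, that is radially symmetric in $x$, with $r=|x|$). Consider the Hamiltonian system $$\dot u=p,\qquad \dot p=-e^{2t}\,W'_u(u,t)$$ (equivalently, the Newton equation $\ddot u=-e^{2t}W'_u(u,t)$). A solution $u(t)$, $t\in\mathbb R$, is said to have conjugate points if there are times $t_1<t_2$ and a not identically vanishing solution $\xi$ of the linearised equation $\ddot\xi+e^{2t}W''_{uu}(u(t),t)\,\xi=0$ with $\xi(t_1)=\xi(t_2)=0$. If $W$ does not vanish identically, then there exists a solution $u:\mathbb R\to\mathbb R$ with conjugate points. Equivalently, if no solution has conjugate points, then $W\equiv 0$. -/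

import Mathlib

/-- The partial derivative `W'_u (u, t)`. -/
noncomputable def partialU (W : ℝ → ℝ → ℝ) (u t : ℝ) : ℝ :=
  deriv (fun x => W x t) u

/-- The second partial derivative `W''_{uu} (u, t)`. -/
noncomputable def partialUU (W : ℝ → ℝ → ℝ) (u t : ℝ) : ℝ :=
  deriv (fun x => partialU W x t) u

/-- `(u, p)` is a solution, defined for all times, of the Hamiltonian system
`u' = p`, `p' = - e ^ (2 t) W'_u (u, t)`. -/
def IsNewtonSolution (W : ℝ → ℝ → ℝ) (u p : ℝ → ℝ) : Prop :=
  ∀ t : ℝ, HasDerivAt u (p t) t ∧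
    HasDerivAt p (-Real.exp (2 * t) * partialU W (u t) t) t

/-- `ξ` solves the linearised (Jacobi) equation
`ξ'' + e ^ (2 t) W''_{uu} (u (t), t) ξ = 0` along `u`; here `η` is `ξ'`. -/
def IsJacobiField (W : ℝ → ℝ → ℝ) (u ξ : ℝ → ℝ) : Prop :=
  ∃ η : ℝ → ℝ, ∀ t : ℝ, HasDerivAt ξ (η t) t ∧
    HasDerivAt η (-Real.exp (2 * t) * partialUU W (u t) t * ξ t) t

/-- Two distinct times are conjugate along `u` if a Jacobi field along `u` that does not vanish
identically is zero at both; `u` has conjugate points if there are two such times. -/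
def HasConjugatePoints (W : ℝ → ℝ → ℝ) (u : ℝ → ℝ) : Prop :=
  ∃ t₁ t₂ : ℝ, t₁ < t₂ ∧ ∃ ξ : ℝ → ℝ, IsJacobiField W u ξ ∧ (∃ t, ξ t ≠ 0) ∧ ξ t₁ = 0 ∧ ξ t₂ = 0

/-! This is an averaging argument in the style of E. Hopf. If a solution has no conjugate points,
its index form `∫ (h' ^ 2 - K * h ^ 2)` with `K = e ^ (2 t) W''_{uu}` is nonnegative on bounded test
functions `h` of finite energy (`IsDisconjugate.integral_univ_nonneg`). Take for `h` the restriction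
to trajectories of a single function on the extended phase space of points `(t, u, p)`. The flow
preserves `du dp` (`exists_newtonFlow`), so if no trajectory had conjugate points, the index density
would have nonnegative integral over the extended phase space
(`exists_integral_neg_of_measurePreserving`). The contradiction comes from a function for which that
integral is negative (`exists_integral_indexDensity_neg`).

The starting point is `h = 1`. Its energy is zero and its curvature term vanishes, because `K` is a
total `u`-derivative of a function with bounded support in `u`. Integrability in `p` forces a cutoff
`φ (p / R)`, whose energy is only of order `1 / R`. Yet `h = 1` is not critical for the averaged
form: adding `ε ψ`, with `ψ` a localised multiple of `-W`, contributes `-2 ε ∫ K ψ`, and integration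
by parts in `u` turns `∫ K ψ` into a weighted integral of `(W'_u) ^ 2`, which is positive. The
remaining term is `O(ε ^ 2)`, so a small `ε` followed by a large `R` gives a negative value. -/

open Set Filter Topology MeasureTheory
open scoped NNReal ENNReal

/-! ### Global evolutions of bounded Lipschitz vector fields -/

section GlobalFlow

variable {E : Type*} [NormedAddCommGroup E] [NormedSpace ℝ E]

theorem IsIntegralCurve.eq_of_lipschitz {v : ℝ → E → E} {K : ℝ≥0}
    (hlip : ∀ t, LipschitzWith K (v t)) {y z : ℝ → E} (hy : IsIntegralCurve y v)
    (hz : IsIntegralCurve z v) {s : ℝ} (h : y s = z s) : y = z :=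
  ODE_solution_unique_univ (s := fun _ => univ) (fun t => (hlip t).lipschitzOnWith)
    (fun t => ⟨hy t, mem_univ _⟩) (fun t => ⟨hz t, mem_univ _⟩) h

/-- Grönwall's inequality, in both time directions. -/
theorem IsIntegralCurve.dist_le_of_lipschitz {v : ℝ → E → E} {K : ℝ≥0}
    (hlip : ∀ t, LipschitzWith K (v t)) {y z : ℝ → E} (hy : IsIntegralCurve y v)
    (hz : IsIntegralCurve z v) (s t : ℝ) :
    dist (y t) (z t) ≤ dist (y s) (z s) * Real.exp (K * |t - s|) := by
  rcases le_total s t with hst | hst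
  · rw [abs_of_nonneg (sub_nonneg.2 hst)]
    exact dist_le_of_trajectories_ODE hlip hy.continuous.continuousOn
      (fun r _ => (hy r).hasDerivWithinAt) hz.continuous.continuousOn
      (fun r _ => (hz r).hasDerivWithinAt) le_rfl t ⟨hst, le_rfl⟩
  -- Backward times reduce to forward ones by reversing time, which preserves the Lipschitz
  -- constant.
  · have hrev : ∀ {w : ℝ → E}, IsIntegralCurve w v →
        IsIntegralCurve (fun r => w (-r)) (fun r x => -v (-r) x) := fun hw r => by
      simpa [Function.comp_def] using (hw (-r)).scomp r (hasDerivAt_neg r)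
    have h := dist_le_of_trajectories_ODE (v := fun r x => -v (-r) x) (K := K) (a := -s) (b := -t)
      (f := fun r => y (-r)) (g := fun r => z (-r)) (δ := dist (y s) (z s))
      (fun r => (hlip (-r)).neg) (hrev hy).continuous.continuousOn
      (fun r _ => (hrev hy r).hasDerivWithinAt) (hrev hz).continuous.continuousOn
      (fun r _ => (hrev hz r).hasDerivWithinAt) (by simp) (-t) ⟨by linarith, le_rfl⟩
    simp only [neg_neg] at h
    rw [abs_of_nonpos (by linarith)]
    convert h using 3
    ring

/-- A global bound on the field removes the smallness condition on time in Picard–Lindelöf: on `[s -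
n, s + n]` the solution stays in a ball of radius `M * n`. Solutions on nested intervals agree by
uniqueness and glue together. -/
theorem exists_isIntegralCurve_of_bounded [CompleteSpace E] {v : ℝ → E → E} {K M : ℝ≥0}
    (hcont : ∀ x, Continuous fun t => v t x) (hlip : ∀ t, LipschitzWith K (v t))
    (hbd : ∀ t x, ‖v t x‖ ≤ M) (s : ℝ) (x : E) :
    ∃ y : ℝ → E, y s = x ∧ IsIntegralCurve y v := by
  have hloc : ∀ n : ℕ, ∃ y : ℝ → E, y s = x ∧
      ∀ t ∈ Icc (s - n) (s + n), HasDerivWithinAt y (v t (y t)) (Icc (s - n) (s + n)) t := by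
    intro n
    have hs : s ∈ Icc (s - (n : ℝ)) (s + n) := by
      have : (0 : ℝ) ≤ n := n.cast_nonneg
      constructor <;> linarith
    have hPL : IsPicardLindelof v (tmin := s - n) (tmax := s + n) ⟨s, hs⟩ x (M * n) 0 M K :=
      { lipschitzOnWith := fun t _ => (hlip t).lipschitzOnWith
        continuousOn := fun x _ => (hcont x).continuousOn
        norm_le := fun t _ x _ => hbd t x
        mul_max_le := by simp }
    exact hPL.exists_eq_forall_mem_Icc_hasDerivWithinAt₀
  choose y hys hy using hloc
  have hagree : ∀ m n : ℕ, m ≤ n → EqOn (y m) (y n) (Icc (s - m) (s + m)) := by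
    intro m n hmn t ht
    have hmn' : (m : ℝ) ≤ n := by exact_mod_cast hmn
    have hsub : Icc (s - (m : ℝ)) (s + m) ⊆ Icc (s - (n : ℝ)) (s + n) :=
      Icc_subset_Icc (by linarith) (by linarith)
    rcases Nat.eq_zero_or_pos m with rfl | hm
    · have : t = s := by
        simp only [Nat.cast_zero, sub_zero, add_zero, Icc_self, mem_singleton_iff] at ht
        exact ht
      rw [this, hys, hys]
    have hm' : (0 : ℝ) < m := by exact_mod_cast hm
    refine ODE_solution_unique_of_mem_Icc (s := fun _ => univ) (t₀ := s)
      (fun t _ => (hlip t).lipschitzOnWith) ⟨by linarith, by linarith⟩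
      (fun t ht => (hy m t ht).continuousWithinAt)
      (fun t ht => (hy m t (Ioo_subset_Icc_self ht)).hasDerivAt (Icc_mem_nhds ht.1 ht.2))
      (fun _ _ => mem_univ _)
      (fun t ht => ((hy n t (hsub ht)).mono hsub).continuousWithinAt)
      (fun t ht => ((hy n t (hsub (Ioo_subset_Icc_self ht))).mono hsub).hasDerivAt
        (Icc_mem_nhds ht.1 ht.2))
      (fun _ _ => mem_univ _) (by rw [hys, hys]) ht
  -- The `+ 1` puts `t` in the interior of its interval, so that a two-sided derivative is
  -- available.
  refine ⟨fun t => y (⌈|t - s|⌉₊ + 1) t, hys _, fun t => ?_⟩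
  set n := ⌈|t - s|⌉₊ + 1 with hn
  have hlt : |t - s| < n := by
    have := Nat.le_ceil (|t - s|)
    rw [hn]; push_cast; linarith
  have hmem : t ∈ Ioo (s - (n : ℝ)) (s + n) := by
    rw [abs_lt] at hlt
    constructor <;> linarith [hlt.1, hlt.2]
  have hd : HasDerivAt (y n) (v t (y n t)) t :=
    (hy n t (Ioo_subset_Icc_self hmem)).hasDerivAt (Icc_mem_nhds hmem.1 hmem.2)
  refine hd.congr_of_eventuallyEq ?_
  filter_upwards [isOpen_Ioo.mem_nhds hmem] with r hr
  have hrs : |r - s| ≤ n := by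
    rw [abs_le]; constructor <;> linarith [hr.1, hr.2]
  have hr' : |r - s| ≤ (⌈|r - s|⌉₊ + 1 : ℕ) := by
    push_cast; linarith [Nat.le_ceil (|r - s|)]
  rcases le_total (⌈|r - s|⌉₊ + 1) n with h | h
  · refine hagree _ _ h ?_
    rw [abs_le] at hr'
    constructor <;> linarith [hr'.1, hr'.2]
  · exact (hagree _ _ h (Ioo_subset_Icc_self hr)).symm

/-- `Φ s t` is the evolution from time `s` to time `t` of the differential equation `y' = v t y`. -/
structure IsEvolution (v : ℝ → E → E) (Φ : ℝ → ℝ → E → E) : Prop where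
  self : ∀ s x, Φ s s x = x
  isIntegralCurve : ∀ s x, IsIntegralCurve (fun t => Φ s t x) v

theorem exists_isEvolution [CompleteSpace E] {v : ℝ → E → E} {K M : ℝ≥0}
    (hcont : ∀ x, Continuous fun t => v t x) (hlip : ∀ t, LipschitzWith K (v t))
    (hbd : ∀ t x, ‖v t x‖ ≤ M) : ∃ Φ, IsEvolution v Φ := by
  choose y hy using exists_isIntegralCurve_of_bounded hcont hlip hbd
  exact ⟨fun s t x => y s x t, fun s x => (hy s x).1, fun s x => (hy s x).2⟩

namespace IsEvolution

variable {v : ℝ → E → E} {Φ : ℝ → ℝ → E → E} {K M : ℝ≥0}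

theorem comp (hΦ : IsEvolution v Φ) (hlip : ∀ t, LipschitzWith K (v t)) (r s t : ℝ) (x : E) :
    Φ s t (Φ r s x) = Φ r t x :=
  congrFun ((hΦ.isIntegralCurve s (Φ r s x)).eq_of_lipschitz hlip (hΦ.isIntegralCurve r x)
    (s := s) (hΦ.self _ _)) t

theorem dist_le (hΦ : IsEvolution v Φ) (hlip : ∀ t, LipschitzWith K (v t)) (s t : ℝ) (x y : E) :
    dist (Φ s t x) (Φ s t y) ≤ Real.exp (K * |t - s|) * dist x y := by
  have := (hΦ.isIntegralCurve s x).dist_le_of_lipschitz hlip (hΦ.isIntegralCurve s y) s t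
  rw [hΦ.self, hΦ.self] at this
  linarith

theorem lipschitzWith (hΦ : IsEvolution v Φ) (hlip : ∀ t, LipschitzWith K (v t)) (s t : ℝ) :
    LipschitzWith (Real.toNNReal (Real.exp (K * |t - s|))) (Φ s t) :=
  LipschitzWith.of_dist_le_mul fun x y => by
    rw [Real.coe_toNNReal _ (Real.exp_nonneg _)]
    exact hΦ.dist_le hlip s t x y

theorem norm_sub_le (hΦ : IsEvolution v Φ) (hbd : ∀ t x, ‖v t x‖ ≤ M) (s t : ℝ) (x : E) :
    ‖Φ s t x - x‖ ≤ M * |t - s| := by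
  have := Convex.norm_image_sub_le_of_norm_hasDerivWithin_le (f := fun t => Φ s t x)
    (s := univ) (x := s) (y := t) (fun r _ => (hΦ.isIntegralCurve s x r).hasDerivWithinAt)
    (fun r _ => hbd r _) convex_univ (mem_univ _) (mem_univ _)
  simpa [hΦ.self] using this

theorem continuous_uncurry (hΦ : IsEvolution v Φ) (hlip : ∀ t, LipschitzWith K (v t)) (s : ℝ) :
    Continuous fun z : ℝ × E => Φ s z.1 z.2 := by
  rw [continuous_iff_continuousAt]
  rintro ⟨t, x⟩
  rw [ContinuousAt, tendsto_iff_dist_tendsto_zero]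
  have hb : ∀ z : ℝ × E, dist (Φ s z.1 z.2) (Φ s t x) ≤
      Real.exp (K * |z.1 - s|) * dist z.2 x + dist (Φ s z.1 x) (Φ s t x) := fun z =>
    (dist_triangle _ (Φ s z.1 x) _).trans (add_le_add_left (hΦ.dist_le hlip s z.1 z.2 x) _)
  refine squeeze_zero (fun _ => dist_nonneg) hb ?_
  have hc : Continuous fun z : ℝ × E =>
      Real.exp (K * |z.1 - s|) * dist z.2 x + dist (Φ s z.1 x) (Φ s t x) := by
    have h1 : Continuous fun z : ℝ × E => Φ s z.1 x :=
      (hΦ.isIntegralCurve s x).continuous.comp continuous_fst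
    exact ((Real.continuous_exp.comp (by fun_prop)).mul (by fun_prop)).add
      (h1.dist continuous_const)
  have := hc.tendsto (t, x)
  simpa using this

end IsEvolution

end GlobalFlow

/-! ### Invariant measures: from Euler steps to the flow -/

section MeasurePreserving

/-- Dominated convergence: the thickened indicators converge pointwise to the indicator of the
closed set `C`, below the indicator of its compact closed 1-thickening. -/
theorem tendsto_integral_thickenedIndicator_of_isCompact {X : Type*} [PseudoMetricSpace X]
    [ProperSpace X] [T2Space X] [MeasurableSpace X] [BorelSpace X] (μ : Measure X)
    [IsFiniteMeasureOnCompacts μ] {C : Set X} (hC : IsCompact C) :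
    Tendsto (fun n : ℕ => ∫ x, (thickenedIndicator (Nat.one_div_pos_of_nat (α := ℝ) (n := n)) C x
      : ℝ) ∂μ) atTop (𝓝 (μ.real C)) := by
  have hpos : ∀ n : ℕ, (0 : ℝ) < 1 / (n + 1) := fun n => Nat.one_div_pos_of_nat
  have hcpt : IsCompact (Metric.cthickening 1 C) := hC.cthickening
  rw [← integral_indicator_one hC.measurableSet]
  refine tendsto_integral_of_dominated_convergence ((Metric.cthickening 1 C).indicator 1)
    (fun n => ?_) ?_ (fun n => ?_) ?_
  · exact (NNReal.continuous_coe.comp (thickenedIndicator (hpos n) C).continuous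
      ).aestronglyMeasurable
  · exact ((continuousOn_const (c := (1 : ℝ))).integrableOn_compact hcpt).integrable_indicator
      hcpt.measurableSet
  · refine Eventually.of_forall fun x => ?_
    by_cases hx : x ∈ Metric.cthickening 1 C
    · rw [indicator_of_mem hx, Real.norm_eq_abs, NNReal.abs_eq]
      exact_mod_cast thickenedIndicator_le_one (hpos n) C x
    · rw [thickenedIndicator_zero (hpos n)]
      · simp [indicator_of_notMem hx]
      · refine fun h => hx (Metric.thickening_subset_cthickening _ _ (Metric.thickening_mono ?_ _ h))
        rw [div_le_one (by positivity)]
        linarith [n.cast_nonneg (α := ℝ)]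
  · refine Eventually.of_forall fun x => ?_
    have h := tendsto_pi_nhds.1 (thickenedIndicator_tendsto_indicator_closure hpos
      tendsto_one_div_add_atTop_nhds_zero_nat C) x
    rw [hC.isClosed.closure_eq] at h
    have h' := (NNReal.continuous_coe.tendsto _).comp h
    have hcoe : C.indicator (1 : X → ℝ) x = ((C.indicator (fun _ => (1 : ℝ≥0)) x : ℝ≥0) : ℝ) := by
      by_cases hx : x ∈ C <;> simp [hx]
    rw [hcoe]
    exact h'

/-- Two regular measures which give the same integral to every compactly supported Lipschitz
function are equal. -/
theorem MeasureTheory.Measure.ext_of_integral_eq_on_lipschitz {X : Type*} [MetricSpace X]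
    [ProperSpace X] [MeasurableSpace X] [BorelSpace X] {μ ν : Measure X} [μ.Regular] [ν.Regular]
    (h : ∀ f : X → ℝ, (∃ L, LipschitzWith L f) → HasCompactSupport f →
      ∫ x, f x ∂μ = ∫ x, f x ∂ν) : μ = ν := by
  -- Outer regularity reduces the claim to open sets and inner regularity to compact ones, whose
  -- measures are limits of integrals of Lipschitz thickened indicators.
  refine OuterRegular.ext_isOpen fun V hV => InnerRegularWRT.eq_of_innerRegularWRT_of_forall_eq
    Regular.innerRegular Regular.innerRegular (fun C (hC : IsCompact C) => ?_) hV
  rw [← measureReal_eq_measureReal_iff hC.measure_ne_top hC.measure_ne_top]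
  refine tendsto_nhds_unique (tendsto_integral_thickenedIndicator_of_isCompact μ hC) ?_
  refine (tendsto_integral_thickenedIndicator_of_isCompact ν hC).congr fun n => ?_
  have hpos : (0 : ℝ) < 1 / (n + 1) := Nat.one_div_pos_of_nat
  refine (h _ ⟨_, (LipschitzWith.subtype_val _).comp (lipschitzWith_thickenedIndicator hpos C)⟩ ?_).symm
  refine HasCompactSupport.intro (K := Metric.cthickening (1 / (n + 1)) C) hC.cthickening
    fun x hx => ?_
  exact NNReal.coe_eq_zero.2 (thickenedIndicator_zero hpos C
    fun hx' => hx (Metric.thickening_subset_cthickening _ _ hx'))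

namespace IsEvolution

variable {E : Type*} [NormedAddCommGroup E] [NormedSpace ℝ E] [ProperSpace E]
  [MeasurableSpace E] [BorelSpace E]
  {v : ℝ → E → E} {Φ : ℝ → ℝ → E → E} {K M : ℝ≥0}

/-- The starting time varies while the final time is fixed. With `g = f ∘ Φ (s + δ) t`, the two
integrals to compare are those of `g` after an Euler step (inserted freely by invariance of `μ`) and
of `g` after the true flow over time `δ`. Since `g` is Lipschitz uniformly in `δ` and the two steps
differ by `o(δ)`, the derivative vanishes. Differentiability of the flow in its initial condition is
never needed. -/
theorem hasDerivAt_integral_comp (hΦ : IsEvolution v Φ) (hlip : ∀ t, LipschitzWith K (v t))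
    (hbd : ∀ t x, ‖v t x‖ ≤ M) {μ : Measure E} [IsFiniteMeasureOnCompacts μ]
    (hμ : ∀ t δ : ℝ, MeasurePreserving (fun x => x + δ • v t x) μ μ) {f : E → ℝ} {L : ℝ≥0}
    (hf : LipschitzWith L f) (hfc : HasCompactSupport f) (s t : ℝ) :
    HasDerivAt (fun r => ∫ x, f (Φ r t x) ∂μ) 0 s := by
  obtain ⟨R, hR⟩ := hfc.isCompact.isBounded.subset_closedBall (0 : E)
  have hfR : ∀ x, R < ‖x‖ → f x = 0 := fun x hx => by
    by_contra hne
    have := hR (subset_tsupport f hne)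
    rw [mem_closedBall_zero_iff] at this
    linarith
  -- For `|δ| ≤ 1`, motion from `s + δ` to `t` covers at most `M * (|t - s| + 1)`, and the Euler or
  -- flow step at most a further `M`. Outside this ball all integrands vanish.
  set ρ : ℝ := R + M * (|t - s| + 2) with hρ
  set B : Set E := Metric.closedBall 0 ρ with hB
  have hBc : IsCompact B := isCompact_closedBall _ _
  set C : ℝ := L * Real.exp (K * (|t - s| + 1)) with hC
  have hC0 : 0 ≤ C := by positivity
  have hΦc : ∀ r r', Continuous (Φ r r') := fun r r' => (hΦ.lipschitzWith hlip r r').continuous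
  have hvc : Continuous (v s) := (hlip s).continuous
  rw [hasDerivAt_iff_tendsto_slope_zero]
  have hlim : Tendsto (fun δ : ℝ => ∫ x in B, C * ‖δ⁻¹ • (Φ s (s + δ) x - x) - v s x‖ ∂μ)
      (𝓝[≠] 0) (𝓝 (∫ x in B, (0 : ℝ) ∂μ)) := by
    refine tendsto_integral_filter_of_dominated_convergence (fun _ => C * (M + M))
      (Eventually.of_forall fun δ => ?_) ?_ ?_ (Eventually.of_forall fun x => ?_)
    · exact (continuous_const.mul ((((hΦc s (s + δ)).sub continuous_id).const_smul _).sub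
        hvc).norm).aestronglyMeasurable
    · filter_upwards [self_mem_nhdsWithin] with δ hδ
      refine Eventually.of_forall fun x => ?_
      rw [Real.norm_of_nonneg (by positivity)]
      refine mul_le_mul_of_nonneg_left ((_root_.norm_sub_le _ _).trans (add_le_add ?_ (hbd s x))) hC0
      have h := hΦ.norm_sub_le hbd s (s + δ) x
      rw [add_sub_cancel_left] at h
      rw [norm_smul, norm_inv, Real.norm_eq_abs, inv_mul_le_iff₀ (abs_pos.2 hδ)]
      linarith
    · exact continuousOn_const.integrableOn_compact hBc
    · have h := hasDerivAt_iff_tendsto_slope_zero.1 (hΦ.isIntegralCurve s x s)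
      simp only [hΦ.self] at h
      have h' := (h.sub_const (v s x)).norm.const_mul C
      simpa using h'
  rw [integral_zero] at hlim
  refine squeeze_zero_norm' ?_ hlim
  filter_upwards [self_mem_nhdsWithin, nhdsWithin_le_nhds (Metric.closedBall_mem_nhds (0 : ℝ)
    one_pos)] with δ hδ hδ1
  rw [mem_closedBall_zero_iff, Real.norm_eq_abs] at hδ1
  have hδ' : 0 < |δ| := abs_pos.2 hδ
  have htδ : |t - (s + δ)| ≤ |t - s| + 1 := by
    have : t - (s + δ) = (t - s) - δ := by ring
    rw [this]
    exact (abs_sub _ _).trans (by linarith)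
  set g : E → ℝ := fun x => f (Φ (s + δ) t x) with hg
  have hgc : Continuous g := hf.continuous.comp (hΦc _ _)
  have hgR : ∀ x, R + M * (|t - s| + 1) < ‖x‖ → g x = 0 := fun x hx => by
    refine hfR _ ?_
    have h1 := hΦ.norm_sub_le hbd (s + δ) t x
    have h2 : ‖x‖ ≤ ‖Φ (s + δ) t x‖ + ‖Φ (s + δ) t x - x‖ := by
      rw [norm_sub_rev]; simpa using norm_add_le (Φ (s + δ) t x) (x - Φ (s + δ) t x)
    have h3 : (M : ℝ) * |t - (s + δ)| ≤ M * (|t - s| + 1) :=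
      mul_le_mul_of_nonneg_left htδ M.2
    linarith
  have hglip : ∀ x y, |g x - g y| ≤ C * ‖x - y‖ := fun x y => by
    have h1 := hf.dist_le_mul (Φ (s + δ) t x) (Φ (s + δ) t y)
    have h2 := hΦ.dist_le hlip (s + δ) t x y
    rw [Real.dist_eq] at h1
    rw [dist_eq_norm x y] at h2
    have h3 : Real.exp (K * |t - (s + δ)|) ≤ Real.exp (K * (|t - s| + 1)) :=
      Real.exp_le_exp.2 (mul_le_mul_of_nonneg_left htδ K.2)
    calc |g x - g y| ≤ L * dist (Φ (s + δ) t x) (Φ (s + δ) t y) := h1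
      _ ≤ L * (Real.exp (K * (|t - s| + 1)) * ‖x - y‖) :=
        mul_le_mul_of_nonneg_left (h2.trans (mul_le_mul_of_nonneg_right h3 (norm_nonneg _))) L.2
      _ = C * ‖x - y‖ := by rw [hC]; ring
  have hMδ : (M : ℝ) * |δ| ≤ M := mul_le_of_le_one_right M.2 hδ1
  have houtside : ∀ {w : E → E}, (∀ x, ‖w x - x‖ ≤ M * |δ|) → ∀ x, x ∉ B → g (w x) = 0 := by
    intro w hw x hx
    rw [hB, mem_closedBall_zero_iff, not_le] at hx
    refine hgR _ ?_
    have h2 : ‖x‖ ≤ ‖w x‖ + ‖w x - x‖ := by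
      rw [norm_sub_rev]; simpa using norm_add_le (w x) (x - w x)
    have := hw x
    rw [hρ] at hx
    linarith
  have h1 : ∫ x, f (Φ (s + δ) t x) ∂μ = ∫ x in B, g (x + δ • v s x) ∂μ := by
    rw [setIntegral_eq_integral_of_forall_compl_eq_zero
      (houtside (w := fun x => x + δ • v s x) fun x => ?_)]
    · conv_lhs => rw [← (hμ s δ).map_eq]
      rw [integral_map (hμ s δ).measurable.aemeasurable]
      rw [(hμ s δ).map_eq]
      exact hgc.aestronglyMeasurable
    · rw [add_sub_cancel_left, norm_smul, Real.norm_eq_abs, mul_comm]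
      exact mul_le_mul_of_nonneg_right (hbd s x) (abs_nonneg δ)
  have h2 : ∫ x, f (Φ s t x) ∂μ = ∫ x in B, g (Φ s (s + δ) x) ∂μ := by
    rw [setIntegral_eq_integral_of_forall_compl_eq_zero (houtside (w := Φ s (s + δ)) fun x => ?_)]
    · simp only [hg, hΦ.comp hlip]
    · simpa using hΦ.norm_sub_le hbd s (s + δ) x
  have hc1 : Continuous fun x => g (x + δ • v s x) :=
    hgc.comp (continuous_id.add (hvc.const_smul δ))
  have hc2 : Continuous fun x => g (Φ s (s + δ) x) := hgc.comp (hΦc _ _)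
  rw [h1, h2, ← integral_sub (hc1.continuousOn.integrableOn_compact hBc)
    (hc2.continuousOn.integrableOn_compact hBc), ← integral_smul]
  refine norm_integral_le_of_norm_le ?_ (Eventually.of_forall fun x => ?_)
  · exact ((continuous_const.mul ((((hΦc s (s + δ)).sub continuous_id).const_smul _).sub
        hvc).norm)).continuousOn.integrableOn_compact hBc
  · have hx : δ⁻¹ • (Φ s (s + δ) x - x) - v s x = (-δ⁻¹) • (x + δ • v s x - Φ s (s + δ) x) := by
      have h3 : v s x = δ⁻¹ • δ • v s x := by rw [smul_smul, inv_mul_cancel₀ hδ, one_smul]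
      nth_rewrite 1 [h3]
      module
    rw [hx, norm_smul, norm_smul, norm_neg, Real.norm_eq_abs (g _ - _)]
    have := mul_le_mul_of_nonneg_left (hglip (x + δ • v s x) (Φ s (s + δ) x))
      (norm_nonneg δ⁻¹)
    linarith

/-- If all forward Euler maps of a bounded Lipschitz vector field preserve a measure, so does the
evolution it generates. -/
theorem measurePreserving (hΦ : IsEvolution v Φ) (hlip : ∀ t, LipschitzWith K (v t))
    (hbd : ∀ t x, ‖v t x‖ ≤ M) {μ : Measure E} [μ.Regular]
    (hμ : ∀ t δ : ℝ, MeasurePreserving (fun x => x + δ • v t x) μ μ) (s t : ℝ) :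
    MeasurePreserving (Φ s t) μ μ := by
  have hΦc : Continuous (Φ s t) := (hΦ.lipschitzWith hlip s t).continuous
  refine ⟨hΦc.measurable, ?_⟩
  -- Points move by at most `M * |t - s|`, so preimages of compact sets are compact. This supplies
  -- the regularity of the pushforward used below.
  have hfin : IsFiniteMeasureOnCompacts (μ.map (Φ s t)) := by
    refine ⟨fun C hC => ?_⟩
    rw [Measure.map_apply hΦc.measurable hC.measurableSet]
    refine IsCompact.measure_lt_top ?_
    refine Metric.isCompact_of_isClosed_isBounded (hC.isClosed.preimage hΦc) ?_
    obtain ⟨R, hR⟩ := hC.isBounded.subset_closedBall (0 : E)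
    refine (Metric.isBounded_closedBall (x := (0 : E)) (r := R + M * |t - s|)).subset fun x hx => ?_
    have h1 := mem_closedBall_zero_iff.1 (hR hx)
    have h2 : ‖x‖ ≤ ‖Φ s t x‖ + ‖Φ s t x - x‖ := by
      rw [norm_sub_rev]; simpa using norm_add_le (Φ s t x) (x - Φ s t x)
    rw [mem_closedBall_zero_iff]
    linarith [hΦ.norm_sub_le hbd s t x]
  refine Measure.ext_of_integral_eq_on_lipschitz fun f ⟨L, hf⟩ hfc => ?_
  rw [integral_map hΦc.measurable.aemeasurable hf.continuous.aestronglyMeasurable]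
  have hder := fun r => hΦ.hasDerivAt_integral_comp hlip hbd hμ hf hfc r t
  have h := is_const_of_deriv_eq_zero (fun r => (hder r).differentiableAt)
    (fun r => (hder r).deriv) s t
  simpa [hΦ.self] using h

end IsEvolution

end MeasurePreserving

/-! ### Disconjugacy and positivity of the index form -/

section Sturm

/-- The pair `(ξ, ξ') = (ξ, η)` solves `ξ'' + k ξ = 0`. -/
def IsHillSolution (k ξ η : ℝ → ℝ) : Prop :=
  ∀ t, HasDerivAt ξ (η t) t ∧ HasDerivAt η (-k t * ξ t) t

/-- No nontrivial solution of `ξ'' + k ξ = 0` has two zeros. -/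
def IsDisconjugate (k : ℝ → ℝ) : Prop :=
  ∀ ξ η : ℝ → ℝ, IsHillSolution k ξ η → (∃ t, ξ t ≠ 0) → ∀ t₁ t₂, t₁ < t₂ → ξ t₁ = 0 → ξ t₂ ≠ 0

/-- The solution vanishing at `a`, obtained in polar coordinates `(ξ, ξ') = r (sin α, cos α)`. -/
theorem exists_isHillSolution {k : ℝ → ℝ} (hk : Continuous k) {C : ℝ} (hC : ∀ t, |k t| ≤ C)
    (a : ℝ) : ∃ ξ η : ℝ → ℝ, IsHillSolution k ξ η ∧ ξ a = 0 ∧ η a ≠ 0 := by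
  have hC0 : 0 ≤ C := (abs_nonneg _).trans (hC 0)
  -- The Prüfer angle equation has a bounded Lipschitz right-hand side, unlike the linear system
  -- itself, so the global existence theorem above applies to it.
  set v : ℝ → ℝ → ℝ := fun t α => Real.cos α ^ 2 + k t * Real.sin α ^ 2 with hv
  have hlip : ∀ t, LipschitzWith (Real.toNNReal (2 + 2 * C)) (v t) := fun t => by
    have hd : ∀ α, HasDerivAt (v t)
        (2 * Real.cos α * (-Real.sin α) + k t * (2 * Real.sin α * Real.cos α)) α := fun α => by
      refine (((Real.hasDerivAt_cos α).fun_pow 2).fun_add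
        (((Real.hasDerivAt_sin α).fun_pow 2).const_mul (k t))).congr_deriv ?_
      simp
    refine lipschitzWith_of_nnnorm_deriv_le (fun α => (hd α).differentiableAt) fun α => ?_
    rw [← NNReal.coe_le_coe, coe_nnnorm, (hd α).deriv, Real.coe_toNNReal _ (by positivity)]
    have h1 : |Real.sin α * Real.cos α| ≤ 1 := by
      rw [abs_mul]
      exact mul_le_one₀ (Real.abs_sin_le_one α) (abs_nonneg _) (Real.abs_cos_le_one α)
    have h2 : 2 * Real.cos α * (-Real.sin α) + k t * (2 * Real.sin α * Real.cos α) =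
      (2 * (k t - 1)) * (Real.sin α * Real.cos α) := by ring
    rw [h2, norm_mul, Real.norm_eq_abs, Real.norm_eq_abs]
    refine (mul_le_of_le_one_right (abs_nonneg _) h1).trans ?_
    rw [abs_mul, abs_two]
    have := (abs_sub (k t) 1).trans (add_le_add_left (hC t) _)
    rw [abs_one] at this
    linarith
  have hbd : ∀ t α, ‖v t α‖ ≤ (Real.toNNReal (1 + C) : ℝ) := fun t α => by
    rw [Real.coe_toNNReal _ (by positivity), Real.norm_eq_abs]
    refine (abs_add_le _ _).trans (add_le_add ?_ ?_)
    · rw [abs_of_nonneg (sq_nonneg _)]; exact Real.cos_sq_le_one α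
    · rw [abs_mul, abs_of_nonneg (sq_nonneg (Real.sin α))]
      exact (mul_le_of_le_one_right (abs_nonneg _) (Real.sin_sq_le_one α)).trans (hC t)
  obtain ⟨α, hαa, hα⟩ := exists_isIntegralCurve_of_bounded (v := v)
    (fun x => by simp only [hv]; fun_prop) hlip hbd a 0
  have hαc : Continuous α := hα.continuous
  -- Once the angle is known, the radius solves a scalar linear equation and is an explicit
  -- exponential.
  set r : ℝ → ℝ := fun t =>
    Real.exp (∫ s in a..t, (1 - k s) * (Real.sin (α s) * Real.cos (α s))) with hr
  have hrd : ∀ t, HasDerivAt r (r t * ((1 - k t) * (Real.sin (α t) * Real.cos (α t)))) t :=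
    fun t => (intervalIntegral.integral_hasDerivAt_right (Continuous.intervalIntegrable
      (by fun_prop) _ _) (Continuous.stronglyMeasurableAtFilter (by fun_prop) _ _)
      (Continuous.continuousAt (by fun_prop))).exp
  refine ⟨fun t => r t * Real.sin (α t), fun t => r t * Real.cos (α t), fun t => ⟨?_, ?_⟩, ?_, ?_⟩
  · refine ((hrd t).fun_mul (hα t).sin).congr_deriv ?_
    simp only [hv]
    linear_combination (r t * Real.cos (α t)) * Real.sin_sq_add_cos_sq (α t)
  · refine ((hrd t).fun_mul (hα t).cos).congr_deriv ?_
    simp only [hv]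
    linear_combination (-(r t * Real.sin (α t) * k t)) * (Real.sin_sq_add_cos_sq (α t))
  · simp [hαa]
  · simp [hαa, hr]

/-- The index form of a disconjugate equation is nonnegative. -/
theorem IsDisconjugate.integral_nonneg {k : ℝ → ℝ} (hdis : IsDisconjugate k) (hk : Continuous k)
    {C : ℝ} (hC : ∀ t, |k t| ≤ C) {a b : ℝ} (hab : a ≤ b) {w w' : ℝ → ℝ}
    (hw : ∀ t, HasDerivAt w (w' t) t) (hw' : Continuous w') (ha : w a = 0) (hb : w b = 0) :
    0 ≤ ∫ t in a..b, (w' t ^ 2 - k t * w t ^ 2) := by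
  -- Placing the zero strictly to the left of `a` keeps `ξ` nonzero on all of `[a, b]`, endpoints
  -- included.
  obtain ⟨ξ, η, hsol, h0, h1⟩ := exists_isHillSolution hk hC (a - 1)
  have hnt : ∃ t, ξ t ≠ 0 := by
    by_contra! hz
    have : ξ = fun _ => 0 := funext hz
    have h2 := (hsol (a - 1)).1
    rw [this] at h2
    exact h1 (h2.unique (hasDerivAt_const _ _))
  have hne : ∀ t ∈ uIcc a b, ξ t ≠ 0 := fun t ht => by
    rw [uIcc_of_le hab] at ht
    exact hdis ξ η hsol hnt (a - 1) t (by linarith [ht.1]) h0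
  have hwc : Continuous w := continuous_iff_continuousAt.2 fun t => (hw t).continuousAt
  have hξc : Continuous ξ := continuous_iff_continuousAt.2 fun t => (hsol t).1.continuousAt
  have hηc : Continuous η := continuous_iff_continuousAt.2 fun t => (hsol t).2.continuousAt
  have hquot : ContinuousOn (fun t => η t / ξ t) (uIcc a b) :=
    hηc.continuousOn.div hξc.continuousOn hne
  have hsq : ContinuousOn (fun t => (w' t - η t / ξ t * w t) ^ 2) (uIcc a b) :=
    (hw'.continuousOn.sub (hquot.mul hwc.continuousOn)).pow 2
  have hI : Continuous fun t => w' t ^ 2 - k t * w t ^ 2 := by fun_prop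
  -- Jacobi's completion of the square: by the Riccati equation for `η / ξ`, the index density is a
  -- perfect square plus an exact derivative that integrates to zero.
  have hderiv : ∀ t ∈ uIcc a b, HasDerivAt (fun t => η t / ξ t * w t ^ 2)
      ((w' t ^ 2 - k t * w t ^ 2) - (w' t - η t / ξ t * w t) ^ 2) t := fun t ht => by
    refine (((hsol t).2.fun_div (hsol t).1 (hne t ht)).fun_mul ((hw t).fun_pow 2)).congr_deriv ?_
    have := hne t ht
    simp
    field_simp
    ring
  have hftc := intervalIntegral.integral_eq_sub_of_hasDerivAt hderiv
    (hI.continuousOn.sub hsq).intervalIntegrable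
  rw [intervalIntegral.integral_sub (hI.intervalIntegrable _ _) hsq.intervalIntegrable, ha, hb]
    at hftc
  have := intervalIntegral.integral_nonneg (μ := volume) hab
    fun t _ => sq_nonneg (w' t - η t / ξ t * w t)
  linarith

/-- The index form of a disconjugate equation on the whole line is nonnegative on bounded functions
of finite energy. -/
theorem IsDisconjugate.integral_univ_nonneg {k : ℝ → ℝ} (hdis : IsDisconjugate k)
    (hk : Continuous k) {C : ℝ} (hC : ∀ t, |k t| ≤ C) {h h' : ℝ → ℝ}
    (hh : ∀ t, HasDerivAt h (h' t) t) (hh' : Continuous h') {B : ℝ} (hB : ∀ t, |h t| ≤ B)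
    (hi : Integrable fun t => h' t ^ 2) (hi' : Integrable fun t => k t * h t ^ 2) :
    0 ≤ ∫ t, (h' t ^ 2 - k t * h t ^ 2) := by
  have hhc : Continuous h := continuous_iff_continuousAt.2 fun t => (hh t).continuousAt
  set N : ℕ → ℝ := fun n => n + 1 with hN
  have hN1 : ∀ n, 1 ≤ N n := fun n => by simp [hN]
  have hNlim : Tendsto N atTop atTop := tendsto_atTop_add_const_right _ _ tendsto_natCast_atTop_atTop
  -- The test function is multiplied by `1 - (t / N) ^ 2`, which vanishes at `±N` and tends to `1`
  -- pointwise.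
  set F : ℕ → ℝ → ℝ := fun n t => (-(2 * t / N n ^ 2) * h t + (1 - (t / N n) ^ 2) * h' t) ^ 2 -
    k t * ((1 - (t / N n) ^ 2) * h t) ^ 2 with hF
  have hFc : ∀ n, Continuous (F n) := fun n => by simp only [hF]; fun_prop
  have hlim : Tendsto (fun n => ∫ t, (Ioc (-N n) (N n)).indicator (F n) t) atTop
      (𝓝 (∫ t, (h' t ^ 2 - k t * h t ^ 2))) := by
    refine tendsto_integral_of_dominated_convergence
      (fun t => 16 * B ^ 2 * (1 + t ^ 2)⁻¹ + 2 * h' t ^ 2 + |k t * h t ^ 2|)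
      (fun n => ((hFc n).aestronglyMeasurable.indicator measurableSet_Ioc))
      (((integrable_inv_one_add_sq.const_mul _).add (hi.const_mul 2)).add hi'.abs)
      (fun n => Eventually.of_forall fun t => ?_) (Eventually.of_forall fun t => ?_)
    · by_cases ht : t ∈ Ioc (-N n) (N n)
      · rw [indicator_of_mem ht, Real.norm_eq_abs]
        have hn := hN1 n
        have htN : t ^ 2 ≤ N n ^ 2 := sq_le_sq' ht.1.le ht.2
        have hx0 : 0 ≤ 1 - (t / N n) ^ 2 := by
          rw [div_pow, sub_nonneg, div_le_one (by positivity)]; exact htN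
        have hx1 : 1 - (t / N n) ^ 2 ≤ 1 := by linarith [sq_nonneg (t / N n)]
        have hx2 : (1 - (t / N n) ^ 2) ^ 2 ≤ 1 := pow_le_one₀ hx0 hx1
        -- Uses `t ^ 2 ≤ N ^ 2` and `1 + t ^ 2 ≤ 2 * N ^ 2`. With `(x + y) ^ 2 ≤ 2 * x ^ 2 + 2 * y ^
        -- 2` this yields the constant `16` in the dominating function.
        have hy : (2 * t / N n ^ 2) ^ 2 ≤ 8 * (1 + t ^ 2)⁻¹ := by
          rw [← div_eq_mul_inv, div_pow, div_le_div_iff₀ (by positivity) (by positivity)]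
          have h1 : t ^ 2 * (1 + t ^ 2) ≤ N n ^ 2 * (2 * N n ^ 2) :=
            mul_le_mul htN (by nlinarith) (by positivity) (by positivity)
          nlinarith
        have hhB : h t ^ 2 ≤ B ^ 2 := sq_le_sq' (neg_le_of_abs_le (hB t)) (le_of_abs_le (hB t))
        have hA : (2 * t / N n ^ 2) ^ 2 * h t ^ 2 ≤ 8 * (1 + t ^ 2)⁻¹ * B ^ 2 :=
          mul_le_mul hy hhB (sq_nonneg _) (by positivity)
        have hA' : (1 - (t / N n) ^ 2) ^ 2 * h' t ^ 2 ≤ h' t ^ 2 :=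
          mul_le_of_le_one_left (sq_nonneg _) hx2
        have hA'' : |k t * ((1 - (t / N n) ^ 2) * h t) ^ 2| ≤ |k t * h t ^ 2| := by
          rw [mul_pow, mul_left_comm, abs_mul, abs_of_nonneg (sq_nonneg (1 - (t / N n) ^ 2))]
          exact mul_le_of_le_one_left (abs_nonneg _) hx2
        refine (abs_sub _ _).trans (add_le_add ?_ hA'')
        rw [abs_of_nonneg (sq_nonneg _)]
        nlinarith [sq_nonneg (-(2 * t / N n ^ 2) * h t - (1 - (t / N n) ^ 2) * h' t)]
      · rw [indicator_of_notMem ht, norm_zero]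
        positivity
    · have h0 : Tendsto (fun n => t / N n) atTop (𝓝 0) := hNlim.const_div_atTop t
      have h1 : Tendsto (fun n => 2 * t / N n ^ 2) atTop (𝓝 0) :=
        ((tendsto_pow_atTop two_ne_zero).comp hNlim).const_div_atTop (2 * t)
      have h2 : Tendsto (fun n => F n t) atTop (𝓝 ((-0 * h t + (1 - 0 ^ 2) * h' t) ^ 2 -
          k t * ((1 - 0 ^ 2) * h t) ^ 2)) :=
        (((h1.neg.mul_const _).add (((h0.pow 2).const_sub 1).mul_const _)).pow 2).sub
          (((((h0.pow 2).const_sub 1).mul_const _).pow 2).const_mul _)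
      have h3 : (-0 * h t + (1 - 0 ^ 2) * h' t) ^ 2 - k t * ((1 - 0 ^ 2) * h t) ^ 2 =
          h' t ^ 2 - k t * h t ^ 2 := by ring
      rw [h3] at h2
      refine h2.congr' ?_
      filter_upwards [hNlim.eventually_gt_atTop |t|] with n hn
      rw [indicator_of_mem]
      rw [abs_lt] at hn
      exact ⟨hn.1, hn.2.le⟩
  refine ge_of_tendsto' hlim fun n => ?_
  have hn := hN1 n
  rw [integral_indicator measurableSet_Ioc, ← intervalIntegral.integral_of_le (by linarith)]
  refine hdis.integral_nonneg hk hC (by linarith) (w := fun t => (1 - (t / N n) ^ 2) * h t)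
    (w' := fun t => -(2 * t / N n ^ 2) * h t + (1 - (t / N n) ^ 2) * h' t) (fun t => ?_)
    (by fun_prop) ?_ ?_
  · refine (((((hasDerivAt_id t).div_const (N n)).fun_pow 2).const_sub 1).fun_mul
      (hh t)).congr_deriv ?_
    simp only [Nat.cast_ofNat, Nat.add_one_sub_one, pow_one, id_eq]
    ring_nf
  · rw [neg_div, div_self (by linarith)]; ring
  · rw [div_self (by linarith)]; ring

end Sturm

/-! ### The volume-preserving flow of the Newton equation -/

section NewtonFlow

theorem measurePreserving_shear_snd {g : ℝ → ℝ} (hg : Measurable g) :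
    MeasurePreserving (fun z : ℝ × ℝ => (z.1, z.2 + g z.1)) volume volume :=
  (MeasurePreserving.id (volume : Measure ℝ)).skew_product (g := fun x y => y + g x)
    (measurable_snd.add (hg.comp measurable_fst))
    (Eventually.of_forall fun x => (measurePreserving_add_right volume (g x)).map_eq)

theorem measurePreserving_shear_fst {g : ℝ → ℝ} (hg : Measurable g) :
    MeasurePreserving (fun z : ℝ × ℝ => (z.1 + g z.2, z.2)) volume volume :=
  (Measure.measurePreserving_swap (μ := volume) (ν := volume)).comp
    ((measurePreserving_shear_snd hg).comp
      (Measure.measurePreserving_swap (μ := volume) (ν := volume)))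

/-- The Newton equation `u'' = a t u` in the variables `(q, p) = (u - t u', u')`. -/
def driftField (a : ℝ → ℝ → ℝ) (t : ℝ) (z : ℝ × ℝ) : ℝ × ℝ :=
  (-t * a t (z.1 + t * z.2), a t (z.1 + t * z.2))

/-- In these coordinates an Euler step is the momentum kick `p ↦ p + δ * a t u` conjugated by the
shear `u = q + t * p`, hence a composition of three shears. -/
theorem measurePreserving_driftField_euler {a : ℝ → ℝ → ℝ} {t : ℝ} (ha : Measurable (a t))
    (δ : ℝ) : MeasurePreserving (fun z => z + δ • driftField a t z) volume volume := by
  convert (measurePreserving_shear_fst (g := fun p => -t * p) (by fun_prop)).comp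
    ((measurePreserving_shear_snd (g := fun u => δ * a t u) (by fun_prop)).comp
      (measurePreserving_shear_fst (g := fun p => t * p) (by fun_prop))) using 1
  ext z
  · simp [driftField]; ring
  · simp [driftField]

/-- Subtracting the free motion removes the unbounded term `u' = p`, at the price of a factor `t`
that the decay of the force absorbs. -/
theorem norm_driftField_le {a : ℝ → ℝ → ℝ} {A : ℝ} (hA : ∀ t u, |a t u| ≤ A * (1 + t ^ 2)⁻¹)
    (t : ℝ) (z : ℝ × ℝ) : ‖driftField a t z‖ ≤ A := by
  have ht : (0 : ℝ) < 1 + t ^ 2 := by positivity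
  have h := hA t (z.1 + t * z.2)
  rw [← div_eq_mul_inv, le_div_iff₀ ht] at h
  have h1 : |t| ≤ 1 + t ^ 2 := by rw [← sq_abs]; nlinarith [sq_nonneg (|t| - 1), abs_nonneg t]
  have h0 := abs_nonneg (a t (z.1 + t * z.2))
  rw [driftField, Prod.norm_mk, max_le_iff, norm_mul, norm_neg, Real.norm_eq_abs, Real.norm_eq_abs]
  constructor
  · nlinarith
  · nlinarith [sq_nonneg t]

theorem lipschitzWith_driftField {a : ℝ → ℝ → ℝ} {A : ℝ≥0}
    (hA : ∀ t u u', |a t u - a t u'| ≤ A * (1 + t ^ 2)⁻¹ * |u - u'|) (t : ℝ) :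
    LipschitzWith (2 * A) (driftField a t) := by
  refine LipschitzWith.of_dist_le_mul fun z w => ?_
  have ht : (0 : ℝ) < 1 + t ^ 2 := by positivity
  have h := hA t (z.1 + t * z.2) (w.1 + t * w.2)
  have hu : |z.1 + t * z.2 - (w.1 + t * w.2)| ≤ (1 + |t|) * ‖z - w‖ := by
    have h1 : |z.1 - w.1| ≤ ‖z - w‖ := norm_fst_le (z - w)
    have h2 : |z.2 - w.2| ≤ ‖z - w‖ := norm_snd_le (z - w)
    have h3 : z.1 + t * z.2 - (w.1 + t * w.2) = (z.1 - w.1) + t * (z.2 - w.2) := by ring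
    rw [h3]
    refine (abs_add_le _ _).trans ?_
    rw [abs_mul]
    nlinarith [abs_nonneg t]
  set d := |a t (z.1 + t * z.2) - a t (w.1 + t * w.2)| with hd
  have hd0 : 0 ≤ d := abs_nonneg _
  have hz : 0 ≤ ‖z - w‖ := norm_nonneg _
  have hkey : d ≤ A * (1 + t ^ 2)⁻¹ * ((1 + |t|) * ‖z - w‖) :=
    h.trans (mul_le_mul_of_nonneg_left hu (by positivity))
  -- Covers both components, with `m = |t|` and `m = 1`; the factor `1 + |t|` comes from `q + t *
  -- p`, and quadratic decay in time suffices for the product.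
  have hbound : ∀ m, 0 ≤ m → m * (1 + |t|) ≤ 2 * (1 + t ^ 2) → m * d ≤ 2 * A * ‖z - w‖ := by
    intro m hm hmt
    calc m * d ≤ m * (A * (1 + t ^ 2)⁻¹ * ((1 + |t|) * ‖z - w‖)) :=
          mul_le_mul_of_nonneg_left hkey hm
      _ = (m * (1 + |t|)) * (A * (1 + t ^ 2)⁻¹ * ‖z - w‖) := by ring
      _ ≤ (2 * (1 + t ^ 2)) * (A * (1 + t ^ 2)⁻¹ * ‖z - w‖) :=
          mul_le_mul_of_nonneg_right hmt (by positivity)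
      _ = 2 * A * ‖z - w‖ := by field_simp
  have htabs := abs_nonneg t
  rw [dist_eq_norm, dist_eq_norm, driftField, driftField, Prod.mk_sub_mk, Prod.norm_mk, max_le_iff,
    ← mul_sub, norm_mul, norm_neg, Real.norm_eq_abs, Real.norm_eq_abs]
  push_cast
  refine ⟨hbound _ htabs ?_, ?_⟩
  · rw [← sq_abs t]; nlinarith [sq_nonneg (|t| - 1)]
  · have := hbound 1 zero_le_one (by rw [← sq_abs t]; nlinarith [sq_nonneg (|t| - 1)])
    rwa [one_mul] at this

/-- The Newton equation `u'' = a t u` with an integrable-in-time Lipschitz force has a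
volume-preserving continuous flow `(t, y) ↦ (u, u')`, where `y` labels the trajectories. -/
theorem exists_newtonFlow {a : ℝ → ℝ → ℝ} (hac : Continuous fun z : ℝ × ℝ => a z.1 z.2) {A : ℝ≥0}
    (hbd : ∀ t u, |a t u| ≤ A * (1 + t ^ 2)⁻¹)
    (hlip : ∀ t u u', |a t u - a t u'| ≤ A * (1 + t ^ 2)⁻¹ * |u - u'|) :
    ∃ X : ℝ × ℝ × ℝ → ℝ × ℝ, Continuous X ∧
      (∀ t, MeasurePreserving (fun y => X (t, y)) volume volume) ∧
      ∀ y t, HasDerivAt (fun s => (X (s, y)).1) (X (t, y)).2 t ∧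
        HasDerivAt (fun s => (X (s, y)).2) (a t (X (t, y)).1) t := by
  have hL := lipschitzWith_driftField hlip
  have hM : ∀ t z, ‖driftField a t z‖ ≤ A := norm_driftField_le hbd
  have hc : ∀ z, Continuous fun t => driftField a t z := fun z => by
    have : Continuous fun t => a t (z.1 + t * z.2) :=
      hac.comp (continuous_id.prodMk (by fun_prop))
    exact (continuous_neg.mul this).prodMk this
  obtain ⟨Φ, hΦ⟩ := exists_isEvolution hc hL hM
  have hat : ∀ t, Continuous (a t) := fun t => hac.comp (Continuous.prodMk_right t)
  have hmp : ∀ t, MeasurePreserving (Φ 0 t) volume volume :=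
    hΦ.measurePreserving hL hM (fun t δ => measurePreserving_driftField_euler (hat t).measurable δ) 0
  have hΦc := hΦ.continuous_uncurry hL 0
  -- Trajectories are labelled by their state at time `0`; a shear returns from `(q, p)` to `(u,
  -- p)`.
  refine ⟨fun z => ((Φ 0 z.1 z.2).1 + z.1 * (Φ 0 z.1 z.2).2, (Φ 0 z.1 z.2).2), by fun_prop,
    fun t => (measurePreserving_shear_fst (g := fun p => t * p) (by fun_prop)).comp (hmp t),
    fun y t => ?_⟩
  have h := hΦ.isIntegralCurve 0 y t
  have h1 : HasDerivAt (fun s => (Φ 0 s y).1)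
    (-t * a t ((Φ 0 t y).1 + t * (Φ 0 t y).2)) t := h.fst
  have h2 : HasDerivAt (fun s => (Φ 0 s y).2) (a t ((Φ 0 t y).1 + t * (Φ 0 t y).2)) t := h.snd
  refine ⟨(h1.fun_add ((hasDerivAt_id t).fun_mul h2)).congr_deriv ?_, h2⟩
  simp

end NewtonFlow

/-! ### Averaging over the extended phase space, and integrability bounds -/

section Averaging

/-- If a function on extended phase space has negative integral, then its integral along some
trajectory of a volume-preserving flow is negative. -/
theorem exists_integral_neg_of_measurePreserving {Y Z : Type*} [MeasureSpace Y] [MeasureSpace Z]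
    [SFinite (volume : Measure Y)] [SFinite (volume : Measure Z)]
    {X : ℝ × Y → Z} (hXm : Measurable X)
    (hX : ∀ t, MeasurePreserving (fun y => X (t, y)) volume volume) {Q : ℝ × Z → ℝ}
    (hQ : Integrable Q) (hneg : ∫ z, Q z < 0) : ∃ y, ∫ t, Q (t, X (t, y)) < 0 := by
  by_contra! hcon
  -- Fibrewise invariance makes this skew product preserve the product measure; Fubini then
  -- integrates along trajectories first.
  have hmp : MeasurePreserving (fun z : ℝ × Y => (z.1, X z)) volume volume :=
    (MeasurePreserving.id (volume : Measure ℝ)).skew_product (g := fun t y => X (t, y)) hXm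
      (Eventually.of_forall fun t => (hX t).map_eq)
  have h1 : ∫ z : ℝ × Y, Q (z.1, X z) = ∫ z, Q z := by
    conv_rhs => rw [← hmp.map_eq]
    rw [integral_map hmp.measurable.aemeasurable]
    rw [hmp.map_eq]
    exact hQ.aestronglyMeasurable
  have hint : Integrable (fun z : ℝ × Y => Q (z.1, X z)) := hmp.integrable_comp_of_integrable hQ
  rw [← h1, Measure.volume_eq_prod, integral_prod_symm _ hint] at hneg
  exact hneg.not_ge (integral_nonneg hcon)

theorem integral_prod_prod_mul {G : ℝ → ℝ → ℝ} {h : ℝ → ℝ}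
    (hF : Integrable fun z : ℝ × ℝ × ℝ => G z.1 z.2.1 * h z.2.2) :
    ∫ z : ℝ × ℝ × ℝ, G z.1 z.2.1 * h z.2.2 = (∫ t, ∫ u, G t u) * ∫ p, h p := by
  rw [Measure.volume_eq_prod, integral_prod _ hF, ← integral_mul_const]
  congr 1
  ext t
  exact integral_prod_mul (G t) h

theorem integrable_of_inv_one_add_sq_bound {F : ℝ × ℝ × ℝ → ℝ} (hF : Continuous F) {C U P : ℝ}
    (hC : ∀ t u p, |F (t, u, p)| ≤ C * (1 + t ^ 2)⁻¹)
    (hU : ∀ t u p, U < |u| → F (t, u, p) = 0) (hP : ∀ t u p, P < |p| → F (t, u, p) = 0) :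
    Integrable F := by
  have hbox : ∀ V : ℝ, Integrable ((Icc (-V) V).indicator fun _ : ℝ => (1 : ℝ)) := fun V =>
    (continuousOn_const.integrableOn_compact isCompact_Icc).integrable_indicator measurableSet_Icc
  refine ((integrable_inv_one_add_sq.const_mul C).mul_prod ((hbox U).mul_prod (hbox P))).mono'
    hF.aestronglyMeasurable (Eventually.of_forall ?_)
  rintro ⟨t, u, p⟩
  rw [Real.norm_eq_abs]
  by_cases hu : U < |u|
  · rw [hU t u p hu, abs_zero, indicator_of_notMem (a := u) (fun h => hu.not_ge (abs_le.2 h))]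
    simp
  by_cases hp : P < |p|
  · rw [hP t u p hp, abs_zero, indicator_of_notMem (a := p) (fun h => hp.not_ge (abs_le.2 h))]
    simp
  rw [not_lt] at hu hp
  rw [indicator_of_mem (a := u) (abs_le.1 hu), indicator_of_mem (a := p) (abs_le.1 hp)]
  simpa using hC t u p

theorem HasCompactSupport.exists_inv_one_add_sq_bound {F : ℝ × ℝ × ℝ → ℝ} (hF : Continuous F)
    (hc : HasCompactSupport F) : ∃ C, 0 ≤ C ∧ ∀ t u p, |F (t, u, p)| ≤ C * (1 + t ^ 2)⁻¹ := by
  have hG : Continuous fun z : ℝ × ℝ × ℝ => (1 + z.1 ^ 2) * F z := by fun_prop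
  obtain ⟨C, hC⟩ := (hc.mul_left (f := fun z : ℝ × ℝ × ℝ => 1 + z.1 ^ 2)).exists_bound_of_continuous hG
  refine ⟨C, (norm_nonneg _).trans (hC 0), fun t u p => ?_⟩
  have h := hC (t, u, p)
  have ht : (0 : ℝ) < 1 + t ^ 2 := by positivity
  simp only [Pi.mul_apply, norm_mul, Real.norm_eq_abs] at h
  rw [abs_of_pos ht] at h
  rw [← div_eq_mul_inv, le_div_iff₀ ht]
  linarith

theorem exists_exp_two_mul_le (T : ℝ) :
    ∃ c : ℝ, 0 ≤ c ∧ ∀ t ≤ T, Real.exp (2 * t) ≤ c * (1 + t ^ 2)⁻¹ := by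
  -- The first summand handles `t ≤ 0`, through `1 + x + x ^ 2 / 2 ≤ exp x` at `x = -2 * t`; the
  -- second handles `0 ≤ t ≤ T` by monotonicity.
  refine ⟨1 + Real.exp (2 * T) * (1 + T ^ 2), by positivity, fun t ht => ?_⟩
  have ht' : (0 : ℝ) < 1 + t ^ 2 := by positivity
  rw [← div_eq_mul_inv, le_div_iff₀ ht']
  rcases le_total t 0 with h0 | h0
  · have h1 := Real.quadratic_le_exp_of_nonneg (x := -(2 * t)) (by linarith)
    have h2 : Real.exp (2 * t) * (1 + t ^ 2) ≤ Real.exp (2 * t) * Real.exp (-(2 * t)) :=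
      mul_le_mul_of_nonneg_left (by nlinarith) (Real.exp_nonneg _)
    rw [← Real.exp_add, add_neg_cancel, Real.exp_zero] at h2
    nlinarith [mul_nonneg (Real.exp_nonneg (2 * T)) (by positivity : (0 : ℝ) ≤ 1 + T ^ 2)]
  · have h1 : Real.exp (2 * t) * (1 + t ^ 2) ≤ Real.exp (2 * T) * (1 + T ^ 2) :=
      mul_le_mul (Real.exp_le_exp.2 (by linarith)) (by nlinarith) ht'.le (Real.exp_nonneg _)
    linarith

end Averaging

/-! ### Derivatives and support of the potential -/

section Potential

/-- The partial derivative `W'_t (u, t)`. -/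
noncomputable def partialT (W : ℝ → ℝ → ℝ) (u t : ℝ) : ℝ :=
  deriv (fun s => W u s) t

variable {W : ℝ → ℝ → ℝ}

theorem hasDerivAt_fst_of_differentiable (hW : Differentiable ℝ fun z : ℝ × ℝ => W z.1 z.2)
    (u t : ℝ) : HasDerivAt (fun x => W x t) (fderiv ℝ (fun z : ℝ × ℝ => W z.1 z.2) (u, t) (1, 0)) u :=
  HasFDerivAt.comp_hasDerivAt (f := fun x => (x, t)) u (hW (u, t)).hasFDerivAt ((hasDerivAt_id u).prodMk (hasDerivAt_const u t))

theorem hasDerivAt_snd_of_differentiable (hW : Differentiable ℝ fun z : ℝ × ℝ => W z.1 z.2)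
    (u t : ℝ) : HasDerivAt (fun s => W u s) (fderiv ℝ (fun z : ℝ × ℝ => W z.1 z.2) (u, t) (0, 1)) t :=
  HasFDerivAt.comp_hasDerivAt (f := fun s => (u, s)) t (hW (u, t)).hasFDerivAt ((hasDerivAt_const t u).prodMk (hasDerivAt_id t))

theorem hasDerivAt_partialU (hW : Differentiable ℝ fun z : ℝ × ℝ => W z.1 z.2) (u t : ℝ) :
    HasDerivAt (fun x => W x t) (partialU W u t) u :=
  (hasDerivAt_fst_of_differentiable hW u t).differentiableAt.hasDerivAt

theorem contDiff_partialU {n : WithTop ℕ∞} (hW : ContDiff ℝ (n + 1) fun z : ℝ × ℝ => W z.1 z.2) :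
    ContDiff ℝ n fun z : ℝ × ℝ => partialU W z.1 z.2 := by
  have h := (hW.fderiv_right (m := n) le_rfl).clm_apply (contDiff_const (c := ((1 : ℝ), (0 : ℝ))))
  have heq : (fun z : ℝ × ℝ => partialU W z.1 z.2) =
      fun z => fderiv ℝ (fun z : ℝ × ℝ => W z.1 z.2) z (1, 0) := funext fun z =>
    (hasDerivAt_fst_of_differentiable (hW.differentiable (by simp)) z.1 z.2).deriv
  rw [heq]
  exact h

theorem continuous_partialT (hW : ContDiff ℝ 1 fun z : ℝ × ℝ => W z.1 z.2) :
    Continuous fun z : ℝ × ℝ => partialT W z.1 z.2 := by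
  have h := (hW.continuous_fderiv one_ne_zero).clm_apply
    (continuous_const (y := ((0 : ℝ), (1 : ℝ))))
  exact h.congr fun z => ((hasDerivAt_snd_of_differentiable
    (hW.differentiable one_ne_zero) z.1 z.2).deriv).symm

theorem hasDerivAt_comp_curve (hW : Differentiable ℝ fun z : ℝ × ℝ => W z.1 z.2) {u : ℝ → ℝ}
    {p t : ℝ} (hu : HasDerivAt u p t) :
    HasDerivAt (fun s => W (u s) s) (partialT W (u t) t + p * partialU W (u t) t) t := by
  have h := HasFDerivAt.comp_hasDerivAt (f := fun s => (u s, s)) t (hW (u t, t)).hasFDerivAt (hu.prodMk (hasDerivAt_id t))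
  refine h.congr_deriv ?_
  have hsplit : (p, (1 : ℝ)) = (0, 1) + p • ((1 : ℝ), (0 : ℝ)) := by simp
  rw [hsplit, map_add, map_smul, partialT, partialU,
    (hasDerivAt_fst_of_differentiable hW (u t) t).deriv,
    (hasDerivAt_snd_of_differentiable hW (u t) t).deriv, smul_eq_mul]

variable {U T : ℝ}

theorem partialU_eq_zero_of_forall (h : ∀ u t, U < |u| ∨ T < t → W u t = 0) (u t : ℝ)
    (hut : U < |u| ∨ T < t) : partialU W u t = 0 := by
  have hev : (fun x => W x t) =ᶠ[𝓝 u] fun _ => 0 := by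
    rcases hut with hu | ht
    · filter_upwards [continuous_abs.continuousAt.eventually (lt_mem_nhds hu)] with x hx
      exact h x t (Or.inl hx)
    · exact Eventually.of_forall fun x => h x t (Or.inr ht)
  rw [partialU, hev.deriv_eq, deriv_const]

theorem partialT_eq_zero_of_forall (h : ∀ u t, U < |u| ∨ T < t → W u t = 0) (u t : ℝ)
    (hut : U < |u| ∨ T < t) : partialT W u t = 0 := by
  have hev : (fun s => W u s) =ᶠ[𝓝 t] fun _ => 0 := by
    rcases hut with hu | ht
    · exact Eventually.of_forall fun s => h u s (Or.inl hu)
    · filter_upwards [lt_mem_nhds ht] with s hs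
      exact h u s (Or.inr hs)
  rw [partialT, hev.deriv_eq, deriv_const]

theorem abs_sub_le_of_partialU_le (hW : Differentiable ℝ fun z : ℝ × ℝ => W z.1 z.2) {C : ℝ}
    (hC : ∀ u t, |partialU W u t| ≤ C) (t u u' : ℝ) : |W u t - W u' t| ≤ C * |u - u'| := by
  simpa using Convex.norm_image_sub_le_of_norm_hasDerivWithin_le (f := fun x => W x t)
    (s := univ) (x := u') (y := u) (fun x _ => (hasDerivAt_partialU hW x t).hasDerivWithinAt)
    (fun x _ => hC x t) convex_univ (mem_univ _) (mem_univ _)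

/-- The support may extend to `t = -∞`, so compactness is unavailable; instead the function is
compared with its zero value at `u = |U| + 1`. -/
theorem exists_bound_of_partialU_le (hW : Differentiable ℝ fun z : ℝ × ℝ => W z.1 z.2) {C : ℝ}
    (hC : ∀ u t, |partialU W u t| ≤ C) (h : ∀ u t, U < |u| ∨ T < t → W u t = 0) :
    ∃ M, ∀ u t, |W u t| ≤ M := by
  have hC0 : 0 ≤ C := (abs_nonneg _).trans (hC 0 0)
  refine ⟨C * (|U| + (|U| + 1)), fun u t => ?_⟩
  by_cases hu : U < |u|
  · rw [h u t (Or.inl hu), abs_zero]; positivity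
  rw [not_lt] at hu
  have h1 := abs_sub_le_of_partialU_le hW hC t u (|U| + 1)
  have h2 : U < |(|U| + 1)| := by
    rw [abs_of_nonneg (by positivity)]; linarith [le_abs_self U]
  rw [h _ t (Or.inl h2), sub_zero] at h1
  refine h1.trans (mul_le_mul_of_nonneg_left ((abs_sub _ _).trans (add_le_add ?_ ?_)) hC0)
  · exact hu.trans (le_abs_self U)
  · rw [abs_of_nonneg (by positivity)]

theorem integral_partialU_eq_zero (hW : ContDiff ℝ 1 fun z : ℝ × ℝ => W z.1 z.2)
    (h : ∀ u t, U < |u| ∨ T < t → W u t = 0) (t : ℝ) : ∫ u, partialU W u t = 0 := by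
  have hd := hW.differentiable one_ne_zero
  have hcs : ∀ {V : ℝ → ℝ → ℝ}, (∀ u t, U < |u| ∨ T < t → V u t = 0) →
      HasCompactSupport fun u => V u t := fun hV =>
    HasCompactSupport.intro (isCompact_Icc (a := -U) (b := U)) fun u hu =>
      hV u t (Or.inl (not_le.1 fun hle => hu (abs_le.1 hle)))
  have hc : Continuous fun z : ℝ × ℝ => partialU W z.1 z.2 :=
    (contDiff_partialU (n := 0) (by simpa using hW)).continuous
  exact integral_eq_zero_of_hasDerivAt_of_integrable (fun u => hasDerivAt_partialU hd u t)
    ((hc.comp (Continuous.prodMk_left t)).integrable_of_hasCompactSupport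
      (hcs (partialU_eq_zero_of_forall h)))
    ((hW.continuous.comp (Continuous.prodMk_left t)).integrable_of_hasCompactSupport (hcs h))

end Potential

/-! ### The test function and its phase-space integrals -/

section TestFunction

/-- A `C¹` cutoff equal to `1` on `[-1, 1]` and to `0` outside `(-2, 2)`. -/
structure IsPlateau (φ : ℝ → ℝ) : Prop where
  contDiff : ContDiff ℝ 1 φ
  eq_one : ∀ x, |x| ≤ 1 → φ x = 1
  eq_zero : ∀ x, 2 ≤ |x| → φ x = 0
  nonneg : ∀ x, 0 ≤ φ x
  le_one : ∀ x, φ x ≤ 1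

theorem exists_isPlateau : ∃ φ, IsPlateau φ := by
  let b : ContDiffBump (0 : ℝ) := ⟨1, 2, one_pos, one_lt_two⟩
  exact ⟨b, b.contDiff, fun x hx => b.one_of_mem_closedBall (by simpa using hx),
    fun x hx => b.zero_of_le_dist (by simpa using hx), fun x => b.nonneg, fun x => b.le_one⟩

namespace IsPlateau

variable {φ : ℝ → ℝ}

theorem continuous (hφ : IsPlateau φ) : Continuous φ := hφ.contDiff.continuous

theorem continuous_deriv (hφ : IsPlateau φ) : Continuous (deriv φ) := hφ.contDiff.continuous_deriv le_rfl

theorem hasDerivAt (hφ : IsPlateau φ) (x : ℝ) : HasDerivAt φ (deriv φ x) x :=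
  (hφ.contDiff.differentiable one_ne_zero x).hasDerivAt

theorem deriv_eq_zero_of_abs_lt (hφ : IsPlateau φ) {x : ℝ} (hx : |x| < 1) : deriv φ x = 0 := by
  have : φ =ᶠ[𝓝 x] fun _ => 1 := by
    filter_upwards [continuous_abs.continuousAt.eventually (gt_mem_nhds hx)] with y hy
    exact hφ.eq_one y hy.le
  rw [this.deriv_eq, deriv_const]

theorem deriv_eq_zero_of_lt_abs (hφ : IsPlateau φ) {x : ℝ} (hx : 2 < |x|) : deriv φ x = 0 := by
  have : φ =ᶠ[𝓝 x] fun _ => 0 := by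
    filter_upwards [continuous_abs.continuousAt.eventually (lt_mem_nhds hx)] with y hy
    exact hφ.eq_zero y hy.le
  rw [this.deriv_eq, deriv_const]

end IsPlateau

/-- The force `-e ^ (2 t) W'_u (u, t)`. -/
noncomputable def force (W : ℝ → ℝ → ℝ) (t u : ℝ) : ℝ :=
  -Real.exp (2 * t) * partialU W u t

/-- A localised multiple of `-W`, the second variation of the action in whose direction is
negative to first order. -/
def perturbation (W : ℝ → ℝ → ℝ) (φ : ℝ → ℝ) (t₀ : ℝ) (z : ℝ × ℝ × ℝ) : ℝ :=
  -(φ (2 * z.2.2) * (φ (z.1 - t₀) * W z.2.1 z.1))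

/-- The derivative of `perturbation` along the Newton flow. -/
noncomputable def perturbationDeriv (W : ℝ → ℝ → ℝ) (φ : ℝ → ℝ) (t₀ : ℝ) (z : ℝ × ℝ × ℝ) : ℝ :=
  -(deriv φ (2 * z.2.2) * (2 * force W z.1 z.2.1) * (φ (z.1 - t₀) * W z.2.1 z.1) +
    φ (2 * z.2.2) * (deriv φ (z.1 - t₀) * W z.2.1 z.1 +
      φ (z.1 - t₀) * (partialT W z.2.1 z.1 + z.2.2 * partialU W z.2.1 z.1)))

/-- The derivative of the momentum cutoff `φ (p / R)` along the Newton flow. -/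
noncomputable def cutoffDeriv (W : ℝ → ℝ → ℝ) (φ : ℝ → ℝ) (R : ℝ) (z : ℝ × ℝ × ℝ) : ℝ :=
  force W z.1 z.2.1 * (deriv φ (z.2.2 / R) / R)

/-- The curvature `e ^ (2 t) W''_{uu} (u, t)`. -/
noncomputable def curvature (W : ℝ → ℝ → ℝ) (t u : ℝ) : ℝ :=
  Real.exp (2 * t) * partialUU W u t

variable {W : ℝ → ℝ → ℝ} {φ : ℝ → ℝ} {U T : ℝ}

theorem continuous_partialU_of_contDiff_two (hW : ContDiff ℝ 2 fun z : ℝ × ℝ => W z.1 z.2) :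
    Continuous fun z : ℝ × ℝ => partialU W z.1 z.2 :=
  (contDiff_partialU (n := 1) (by simpa [one_add_one_eq_two] using hW)).continuous

theorem continuous_partialUU (hW : ContDiff ℝ 2 fun z : ℝ × ℝ => W z.1 z.2) :
    Continuous fun z : ℝ × ℝ => partialUU W z.1 z.2 :=
  (contDiff_partialU (W := partialU W) (n := 0)
    (by simpa using contDiff_partialU (n := 1) (by simpa [one_add_one_eq_two] using hW))).continuous

theorem continuous_force (hW : ContDiff ℝ 2 fun z : ℝ × ℝ => W z.1 z.2) :
    Continuous fun z : ℝ × ℝ => force W z.1 z.2 :=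
  (Continuous.neg (by fun_prop)).mul ((continuous_partialU_of_contDiff_two hW).comp continuous_swap)

theorem continuous_curvature (hW : ContDiff ℝ 2 fun z : ℝ × ℝ => W z.1 z.2) :
    Continuous fun z : ℝ × ℝ => curvature W z.1 z.2 :=
  Continuous.mul (by fun_prop) ((continuous_partialUU hW).comp continuous_swap)

theorem Continuous.comp_time_position {G : ℝ → ℝ → ℝ} (hG : Continuous fun z : ℝ × ℝ => G z.1 z.2) :
    Continuous fun z : ℝ × ℝ × ℝ => G z.1 z.2.1 :=
  hG.comp (continuous_fst.prodMk continuous_snd.fst)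

theorem Continuous.comp_position_time {G : ℝ → ℝ → ℝ} (hG : Continuous fun z : ℝ × ℝ => G z.1 z.2) :
    Continuous fun z : ℝ × ℝ × ℝ => G z.2.1 z.1 :=
  hG.comp (continuous_snd.fst.prodMk continuous_fst)

theorem continuous_perturbation (hW : ContDiff ℝ 2 fun z : ℝ × ℝ => W z.1 z.2) (hφ : IsPlateau φ)
    (t₀ : ℝ) : Continuous (perturbation W φ t₀) := by
  have h1 := hφ.continuous
  have h2 := hW.continuous.comp_position_time
  unfold perturbation
  fun_prop

theorem continuous_perturbationDeriv (hW : ContDiff ℝ 2 fun z : ℝ × ℝ => W z.1 z.2)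
    (hφ : IsPlateau φ) (t₀ : ℝ) : Continuous (perturbationDeriv W φ t₀) := by
  have h1 := hφ.continuous
  have h1' := hφ.continuous_deriv
  have h2 := hW.continuous.comp_position_time
  have h3 := (continuous_partialU_of_contDiff_two hW).comp_position_time
  have h4 := (continuous_partialT (hW.of_le one_le_two)).comp_position_time
  have h5 := (continuous_force hW).comp_time_position
  unfold perturbationDeriv
  fun_prop

theorem continuous_cutoffDeriv (hW : ContDiff ℝ 2 fun z : ℝ × ℝ => W z.1 z.2) (hφ : IsPlateau φ)
    (R : ℝ) : Continuous (cutoffDeriv W φ R) := by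
  have h1' := hφ.continuous_deriv
  have h5 := (continuous_force hW).comp_time_position
  unfold cutoffDeriv
  fun_prop

theorem hasDerivAt_testFunction (hW : Differentiable ℝ fun z : ℝ × ℝ => W z.1 z.2)
    (hφ : IsPlateau φ) (t₀ R ε : ℝ) {u p : ℝ → ℝ} {t : ℝ} (hu : HasDerivAt u (p t) t)
    (hp : HasDerivAt p (force W t (u t)) t) :
    HasDerivAt (fun s => φ (p s / R) + ε * perturbation W φ t₀ (s, u s, p s))
      (cutoffDeriv W φ R (t, u t, p t) + ε * perturbationDeriv W φ t₀ (t, u t, p t)) t := by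
  have h1 : HasDerivAt (fun s => φ (p s / R)) (deriv φ (p t / R) * (force W t (u t) / R)) t :=
    (hφ.hasDerivAt _).comp t (hp.div_const R)
  have h2 : HasDerivAt (fun s => φ (2 * p s)) (deriv φ (2 * p t) * (2 * force W t (u t))) t :=
    (hφ.hasDerivAt _).comp t (hp.const_mul 2)
  have h3 : HasDerivAt (fun s => φ (s - t₀)) (deriv φ (t - t₀) * 1) t :=
    (hφ.hasDerivAt _).comp t ((hasDerivAt_id t).sub_const t₀)
  have h4 := hasDerivAt_comp_curve hW hu
  refine (h1.fun_add (((h2.fun_mul (h3.fun_mul h4)).fun_neg).const_mul ε)).congr_deriv ?_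
  simp only [cutoffDeriv, perturbationDeriv]
  ring

theorem perturbation_eq_zero (hφ : IsPlateau φ) (h0 : ∀ u t, U < |u| ∨ T < t → W u t = 0)
    (t₀ : ℝ) {z : ℝ × ℝ × ℝ} (hz : 2 < |z.1 - t₀| ∨ U < |z.2.1| ∨ 1 < |z.2.2|) :
    perturbation W φ t₀ z = 0 := by
  unfold perturbation
  rcases hz with h | h | h
  · rw [hφ.eq_zero _ h.le]; ring
  · rw [h0 _ _ (Or.inl h)]; ring
  · rw [hφ.eq_zero (2 * z.2.2) (by rw [abs_mul, abs_two]; linarith)]; ring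

theorem perturbationDeriv_eq_zero (hφ : IsPlateau φ) (h0 : ∀ u t, U < |u| ∨ T < t → W u t = 0)
    (t₀ : ℝ) {z : ℝ × ℝ × ℝ} (hz : 2 < |z.1 - t₀| ∨ U < |z.2.1| ∨ 1 < |z.2.2|) :
    perturbationDeriv W φ t₀ z = 0 := by
  unfold perturbationDeriv
  rcases hz with h | h | h
  · rw [hφ.eq_zero _ h.le, hφ.deriv_eq_zero_of_lt_abs h]; ring
  · rw [h0 _ _ (Or.inl h), partialU_eq_zero_of_forall h0 _ _ (Or.inl h),
      partialT_eq_zero_of_forall h0 _ _ (Or.inl h)]; ring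
  · have h2 : 2 < |2 * z.2.2| := by rw [abs_mul, abs_two]; linarith
    rw [hφ.eq_zero _ h2.le, hφ.deriv_eq_zero_of_lt_abs h2]; ring

theorem hasCompactSupport_of_box {F : ℝ × ℝ × ℝ → ℝ} {t₀ U : ℝ}
    (h : ∀ z : ℝ × ℝ × ℝ, 2 < |z.1 - t₀| ∨ U < |z.2.1| ∨ 1 < |z.2.2| → F z = 0) :
    HasCompactSupport F := by
  refine HasCompactSupport.intro (K := Icc (t₀ - 2) (t₀ + 2) ×ˢ (Icc (-U) U ×ˢ Icc (-1) 1))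
    (isCompact_Icc.prod (isCompact_Icc.prod isCompact_Icc)) fun z hz => h z ?_
  by_contra! hcon
  obtain ⟨h1, h2, h3⟩ := hcon
  rw [abs_le] at h1 h2 h3
  exact hz ⟨⟨by linarith [h1.1], by linarith [h1.2]⟩, h2, h3⟩

theorem hasCompactSupport_perturbation (hφ : IsPlateau φ)
    (h0 : ∀ u t, U < |u| ∨ T < t → W u t = 0) (t₀ : ℝ) :
    HasCompactSupport (perturbation W φ t₀) :=
  hasCompactSupport_of_box fun _ hz => perturbation_eq_zero hφ h0 t₀ hz

theorem hasCompactSupport_perturbationDeriv (hφ : IsPlateau φ)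
    (h0 : ∀ u t, U < |u| ∨ T < t → W u t = 0) (t₀ : ℝ) :
    HasCompactSupport (perturbationDeriv W φ t₀) :=
  hasCompactSupport_of_box fun _ hz => perturbationDeriv_eq_zero hφ h0 t₀ hz

theorem exists_exp_mul_bound {V : ℝ → ℝ → ℝ} {M : ℝ} (hM : ∀ u t, |V u t| ≤ M)
    (h0 : ∀ u t, U < |u| ∨ T < t → V u t = 0) :
    ∃ c : ℝ, 0 ≤ c ∧ ∀ t u, |Real.exp (2 * t) * V u t| ≤ c * (1 + t ^ 2)⁻¹ := by
  obtain ⟨c, hc, hexp⟩ := exists_exp_two_mul_le T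
  have hM0 : 0 ≤ M := (abs_nonneg _).trans (hM 0 0)
  refine ⟨c * M, by positivity, fun t u => ?_⟩
  by_cases ht : T < t
  · rw [h0 u t (Or.inr ht), mul_zero, abs_zero]; positivity
  · rw [abs_mul, abs_of_nonneg (Real.exp_nonneg _)]
    calc Real.exp (2 * t) * |V u t| ≤ (c * (1 + t ^ 2)⁻¹) * M :=
          mul_le_mul (hexp t (not_lt.1 ht)) (hM u t) (abs_nonneg _) (by positivity)
      _ = c * M * (1 + t ^ 2)⁻¹ := by ring

/-- Boundedness of `W''_{uu}` passes to `W'_u` because the latter vanishes for `|u| > U`. Decay in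
time comes from the exponential in the past and from the support for `t > T`. -/
theorem exists_force_bound (hW : ContDiff ℝ 2 fun z : ℝ × ℝ => W z.1 z.2)
    (h0 : ∀ u t, U < |u| ∨ T < t → W u t = 0) {C : ℝ} (hC : ∀ u t, |partialUU W u t| ≤ C) :
    ∃ c : ℝ, 0 ≤ c ∧ ∀ t u, |force W t u| ≤ c * (1 + t ^ 2)⁻¹ := by
  have hd : Differentiable ℝ fun z : ℝ × ℝ => partialU W z.1 z.2 :=
    (contDiff_partialU (n := 1) (by simpa [one_add_one_eq_two] using hW)).differentiable one_ne_zero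
  obtain ⟨M, hM⟩ := exists_bound_of_partialU_le hd hC (partialU_eq_zero_of_forall h0)
  obtain ⟨c, hc, h⟩ := exists_exp_mul_bound hM (partialU_eq_zero_of_forall h0)
  refine ⟨c, hc, fun t u => ?_⟩
  rw [force, neg_mul, abs_neg]
  exact h t u

theorem exists_curvature_bound (h0 : ∀ u t, U < |u| ∨ T < t → W u t = 0) {C : ℝ}
    (hC : ∀ u t, |partialUU W u t| ≤ C) :
    ∃ c : ℝ, 0 ≤ c ∧ ∀ t u, |curvature W t u| ≤ c * (1 + t ^ 2)⁻¹ :=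
  exists_exp_mul_bound hC (partialU_eq_zero_of_forall (partialU_eq_zero_of_forall h0))

theorem abs_force_sub_le (hW : ContDiff ℝ 2 fun z : ℝ × ℝ => W z.1 z.2) {c : ℝ}
    (hc : ∀ t u, |curvature W t u| ≤ c * (1 + t ^ 2)⁻¹) (t u u' : ℝ) :
    |force W t u - force W t u'| ≤ c * (1 + t ^ 2)⁻¹ * |u - u'| := by
  have hd : Differentiable ℝ fun z : ℝ × ℝ => partialU W z.1 z.2 :=
    (contDiff_partialU (n := 1) (by simpa [one_add_one_eq_two] using hW)).differentiable one_ne_zero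
  have hder : ∀ x, HasDerivAt (force W t) (-Real.exp (2 * t) * partialUU W x t) x := fun x =>
    (hasDerivAt_partialU hd x t).const_mul _
  simpa using Convex.norm_image_sub_le_of_norm_hasDerivWithin_le (f := force W t)
    (s := univ) (x := u') (y := u) (C := c * (1 + t ^ 2)⁻¹) (fun x _ => (hder x).hasDerivWithinAt)
    (fun x _ => by rw [neg_mul, norm_neg]; exact hc t x) convex_univ (mem_univ _) (mem_univ _)

theorem inv_one_add_sq_sq_le (t : ℝ) : ((1 + t ^ 2)⁻¹) ^ 2 ≤ (1 + t ^ 2)⁻¹ := by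
  have h1 : (1 + t ^ 2)⁻¹ ≤ 1 := inv_le_one_of_one_le₀ (by nlinarith [sq_nonneg t])
  exact pow_le_of_le_one (by positivity) h1 two_ne_zero

theorem integrable_cutoffDeriv_sq (hW : ContDiff ℝ 2 fun z : ℝ × ℝ => W z.1 z.2)
    (hφ : IsPlateau φ) (h0 : ∀ u t, U < |u| ∨ T < t → W u t = 0) {C : ℝ}
    (hC : ∀ u t, |partialUU W u t| ≤ C) {R : ℝ} (hR : 0 < R) :
    Integrable fun z => cutoffDeriv W φ R z ^ 2 := by
  obtain ⟨c, hc, hf⟩ := exists_force_bound hW h0 hC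
  have hzero : ∀ x, 2 < |x| → deriv φ x = 0 := fun x hx => hφ.deriv_eq_zero_of_lt_abs hx
  obtain ⟨D, hD⟩ := (HasCompactSupport.intro (isCompact_Icc (a := (-2 : ℝ)) (b := 2))
    (f := deriv φ) fun x hx => hzero x (not_le.1 fun h => hx (abs_le.1 h))
    ).exists_bound_of_continuous hφ.continuous_deriv
  refine integrable_of_inv_one_add_sq_bound (C := c ^ 2 * (D / R) ^ 2) (U := U) (P := 2 * R)
    ((continuous_cutoffDeriv hW hφ R).pow 2) (fun t u p => ?_) (fun t u p hu => ?_)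
    (fun t u p hp => ?_)
  · have h1 : force W t u ^ 2 ≤ c ^ 2 * (1 + t ^ 2)⁻¹ := by
      have h2 : |force W t u| ^ 2 ≤ (c * (1 + t ^ 2)⁻¹) ^ 2 :=
        pow_le_pow_left₀ (abs_nonneg _) (hf t u) 2
      rw [sq_abs, mul_pow] at h2
      exact h2.trans (mul_le_mul_of_nonneg_left (inv_one_add_sq_sq_le t) (sq_nonneg c))
    have h3 : (deriv φ (p / R) / R) ^ 2 ≤ (D / R) ^ 2 := by
      rw [← sq_abs (deriv φ (p / R) / R), abs_div, abs_of_pos hR]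
      exact pow_le_pow_left₀ (by positivity) (div_le_div_of_nonneg_right (hD _) hR.le) 2
    rw [abs_of_nonneg (sq_nonneg _), cutoffDeriv, mul_pow]
    calc _ ≤ (c ^ 2 * (1 + t ^ 2)⁻¹) * (D / R) ^ 2 :=
          mul_le_mul h1 h3 (sq_nonneg _) (by positivity)
      _ = _ := by ring
  · simp [cutoffDeriv, force, partialU_eq_zero_of_forall h0 u t (Or.inl hu)]
  · have : 2 < |p / R| := by rwa [abs_div, abs_of_pos hR, lt_div_iff₀ hR]
    simp [cutoffDeriv, hzero _ this]

/-- Scaling in `p`: the squared derivative carries `R⁻²` and the substitution `p ↦ p / R` gives back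
one factor `R`. This decay makes the momentum cutoff harmless. -/
theorem integral_cutoffDeriv_sq (hW : ContDiff ℝ 2 fun z : ℝ × ℝ => W z.1 z.2)
    (hφ : IsPlateau φ) (h0 : ∀ u t, U < |u| ∨ T < t → W u t = 0) {C : ℝ}
    (hC : ∀ u t, |partialUU W u t| ≤ C) {R : ℝ} (hR : 0 < R) :
    ∫ z, cutoffDeriv W φ R z ^ 2 =
      ((∫ t, ∫ u, force W t u ^ 2) * ∫ p, deriv φ p ^ 2) / R := by
  have hi := integrable_cutoffDeriv_sq hW hφ h0 hC hR
  simp only [cutoffDeriv, mul_pow] at hi ⊢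
  rw [integral_prod_prod_mul (G := fun t u => force W t u ^ 2)
    (h := fun p => (deriv φ (p / R) / R) ^ 2) hi]
  simp only [div_pow]
  rw [integral_div, Measure.integral_comp_div (fun p => deriv φ p ^ 2), abs_of_pos hR, smul_eq_mul]
  field_simp

theorem integrable_curvature_mul_cutoff_sq (hW : ContDiff ℝ 2 fun z : ℝ × ℝ => W z.1 z.2)
    (hφ : IsPlateau φ) (h0 : ∀ u t, U < |u| ∨ T < t → W u t = 0) {C : ℝ}
    (hC : ∀ u t, |partialUU W u t| ≤ C) {R : ℝ} (hR : 0 < R) :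
    Integrable fun z : ℝ × ℝ × ℝ => curvature W z.1 z.2.1 * φ (z.2.2 / R) ^ 2 := by
  obtain ⟨c, hc, hf⟩ := exists_curvature_bound h0 hC
  have h1 := hφ.continuous
  have h2 := (continuous_curvature hW).comp_time_position
  refine integrable_of_inv_one_add_sq_bound (C := c) (U := U) (P := 2 * R) (by fun_prop)
    (fun t u p => ?_) (fun t u p hu => ?_) (fun t u p hp => ?_)
  · rw [abs_mul, abs_of_nonneg (a := φ _ ^ 2) (sq_nonneg _)]
    exact (mul_le_of_le_one_right (abs_nonneg _)
      (pow_le_one₀ (hφ.nonneg _) (hφ.le_one _))).trans (hf t u)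
  · have : partialUU W u t = 0 :=
      partialU_eq_zero_of_forall (partialU_eq_zero_of_forall h0) u t (Or.inl hu)
    simp [curvature, this]
  · have : 2 ≤ |p / R| := by
      rw [abs_div, abs_of_pos hR, le_div_iff₀ hR]; exact hp.le
    simp [hφ.eq_zero _ this]

/-- The cutoff depends on `p` alone, and at each time the curvature is the `u`-derivative of a
compactly supported function of `u`. -/
theorem integral_curvature_mul_cutoff_sq (hW : ContDiff ℝ 2 fun z : ℝ × ℝ => W z.1 z.2)
    (hφ : IsPlateau φ) (h0 : ∀ u t, U < |u| ∨ T < t → W u t = 0) {C : ℝ}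
    (hC : ∀ u t, |partialUU W u t| ≤ C) {R : ℝ} (hR : 0 < R) :
    ∫ z : ℝ × ℝ × ℝ, curvature W z.1 z.2.1 * φ (z.2.2 / R) ^ 2 = 0 := by
  rw [integral_prod_prod_mul (G := curvature W) (h := fun p => φ (p / R) ^ 2)
    (integrable_curvature_mul_cutoff_sq hW hφ h0 hC hR)]
  have hzero : ∀ t, ∫ u, curvature W t u = 0 := fun t => by
    simp only [curvature]
    rw [integral_const_mul]
    rw [show (fun u => partialUU W u t) = fun u => partialU (partialU W) u t from rfl,
      integral_partialU_eq_zero (contDiff_partialU (n := 1) (by simpa [one_add_one_eq_two] using hW))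
        (partialU_eq_zero_of_forall h0), mul_zero]
  simp [hzero]

theorem integrable_curvature_mul_perturbation (hW : ContDiff ℝ 2 fun z : ℝ × ℝ => W z.1 z.2)
    (hφ : IsPlateau φ) (h0 : ∀ u t, U < |u| ∨ T < t → W u t = 0) (t₀ : ℝ) :
    Integrable fun z : ℝ × ℝ × ℝ => curvature W z.1 z.2.1 * perturbation W φ t₀ z :=
  (Continuous.mul (continuous_curvature hW).comp_time_position
    (continuous_perturbation hW hφ t₀)).integrable_of_hasCompactSupport
    (hasCompactSupport_perturbation hφ h0 t₀).mul_left

/-- Integration by parts in `u`: `-W * W''_{uu} = (W'_u) ^ 2 - (W * W'_u)'_u`. The exact term `Z`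
integrates to zero and the square `S` remains, positive at `(t₀, u₀, 0)`, where both cutoffs equal
`1`. -/
theorem integral_curvature_mul_perturbation_pos (hW : ContDiff ℝ 2 fun z : ℝ × ℝ => W z.1 z.2)
    (hφ : IsPlateau φ) (h0 : ∀ u t, U < |u| ∨ T < t → W u t = 0) {u₀ t₀ : ℝ}
    (hne : partialU W u₀ t₀ ≠ 0) :
    0 < ∫ z : ℝ × ℝ × ℝ, curvature W z.1 z.2.1 * perturbation W φ t₀ z := by
  have hW1 : ContDiff ℝ 1 fun z : ℝ × ℝ => partialU W z.1 z.2 :=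
    contDiff_partialU (n := 1) (by simpa [one_add_one_eq_two] using hW)
  set V : ℝ → ℝ → ℝ := fun u t => W u t * partialU W u t with hV
  have hV1 : ContDiff ℝ 1 fun z : ℝ × ℝ => V z.1 z.2 := (hW.of_le one_le_two).mul hW1
  have hV0 : ∀ u t, U < |u| ∨ T < t → V u t = 0 := fun u t h => by
    simp only [hV, h0 u t h, zero_mul]
  have hVu : ∀ u t, partialU V u t = partialU W u t ^ 2 + W u t * partialUU W u t := fun u t => by
    have h := (hasDerivAt_partialU (hW.differentiable two_ne_zero) u t).mul
      (hasDerivAt_partialU (hW1.differentiable one_ne_zero) u t)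
    refine h.deriv.trans ?_
    rw [sq]; rfl
  have hφc := hφ.continuous
  have hUc := (continuous_partialU_of_contDiff_two hW).comp_position_time
  set S : ℝ × ℝ × ℝ → ℝ := fun z =>
    Real.exp (2 * z.1) * φ (z.1 - t₀) * partialU W z.2.1 z.1 ^ 2 * φ (2 * z.2.2) with hS
  have hSc : Continuous S := by simp only [hS]; fun_prop
  have hbox : ∀ {G : ℝ × ℝ × ℝ → ℝ} {H : ℝ → ℝ → ℝ},
      (∀ z : ℝ × ℝ × ℝ, G z = Real.exp (2 * z.1) * φ (z.1 - t₀) * H z.2.1 z.1 * φ (2 * z.2.2)) →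
      (∀ u t, U < |u| ∨ T < t → H u t = 0) → HasCompactSupport G := by
    intro G H hG hH
    refine hasCompactSupport_of_box (t₀ := t₀) (U := U) fun z hz => ?_
    rw [hG]
    rcases hz with h | h | h
    · rw [hφ.eq_zero _ h.le]; ring
    · rw [hH _ _ (Or.inl h)]; ring
    · rw [hφ.eq_zero (2 * z.2.2) (by rw [abs_mul, abs_two]; linarith)]; ring
  have hSs : HasCompactSupport S := hbox (H := fun u t => partialU W u t ^ 2) (fun z => rfl)
    fun u t h => by rw [partialU_eq_zero_of_forall h0 u t h]; ring
  set Z : ℝ × ℝ × ℝ → ℝ := fun z =>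
    (Real.exp (2 * z.1) * φ (z.1 - t₀) * partialU V z.2.1 z.1) * φ (2 * z.2.2) with hZ
  have hZc : Continuous Z := by
    have := ((contDiff_partialU (n := 0) (by simpa using hV1)).continuous).comp_position_time
    simp only [hZ]; fun_prop
  have hZs : HasCompactSupport Z := hbox (H := partialU V) (fun z => rfl)
    (partialU_eq_zero_of_forall hV0)
  have hZi : Integrable Z := hZc.integrable_of_hasCompactSupport hZs
  have hZ0 : ∫ z, Z z = 0 := by
    have h := integral_prod_prod_mul
      (G := fun t u => Real.exp (2 * t) * φ (t - t₀) * partialU V u t) (h := fun p => φ (2 * p)) hZi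
    refine h.trans ?_
    have hzero : ∀ t, ∫ u, Real.exp (2 * t) * φ (t - t₀) * partialU V u t = 0 := fun t => by
      rw [integral_const_mul, integral_partialU_eq_zero hV1 hV0, mul_zero]
    simp [hzero]
  have hSpos : 0 < ∫ z, S z := by
    refine hSc.integral_pos_of_hasCompactSupport_nonneg_nonzero hSs (fun z => ?_)
      (x := (t₀, u₀, 0)) ?_
    · exact mul_nonneg (mul_nonneg (mul_nonneg (Real.exp_nonneg _) (hφ.nonneg _)) (sq_nonneg _))
        (hφ.nonneg _)
    · simp only [hS, sub_self, mul_zero]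
      rw [hφ.eq_one 0 (by simp)]
      simp [hne]
  have heq : (fun z : ℝ × ℝ × ℝ => curvature W z.1 z.2.1 * perturbation W φ t₀ z) =
      fun z => S z - Z z := by
    ext z
    simp only [curvature, perturbation, hS, hZ, hVu]
    ring
  rw [heq, integral_sub (hSc.integrable_of_hasCompactSupport hSs) hZi, hZ0, sub_zero]
  exact hSpos

end TestFunction

/-! ### Negativity of the averaged index form and conclusion -/

section Main

variable {W : ℝ → ℝ → ℝ} {φ : ℝ → ℝ} {U T : ℝ}

/-- The index form density of the test function `φ (p / R) + ε * perturbation`. -/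
noncomputable def indexDensity (W : ℝ → ℝ → ℝ) (φ : ℝ → ℝ) (t₀ R ε : ℝ) (z : ℝ × ℝ × ℝ) : ℝ :=
  (cutoffDeriv W φ R z + ε * perturbationDeriv W φ t₀ z) ^ 2 -
    curvature W z.1 z.2.1 * (φ (z.2.2 / R) + ε * perturbation W φ t₀ z) ^ 2

/-- The perturbation lives in `|p| ≤ 1`, where `R ≥ 2` forces `φ (p / R) = 1` with zero derivative.
Thus the cross term of the derivatives disappears and the one with the curvature loses its cutoff.
-/
theorem indexDensity_eq (hφ : IsPlateau φ) (h0 : ∀ u t, U < |u| ∨ T < t → W u t = 0)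
    (t₀ ε : ℝ) {R : ℝ} (hR : 2 ≤ R) (z : ℝ × ℝ × ℝ) :
    indexDensity W φ t₀ R ε z = cutoffDeriv W φ R z ^ 2 +
      ε ^ 2 * (perturbationDeriv W φ t₀ z ^ 2 -
        curvature W z.1 z.2.1 * perturbation W φ t₀ z ^ 2) -
      curvature W z.1 z.2.1 * φ (z.2.2 / R) ^ 2 -
      2 * ε * (curvature W z.1 z.2.1 * perturbation W φ t₀ z) := by
  have hR0 : 0 < R := by linarith
  unfold indexDensity
  by_cases hp : 1 < |z.2.2|
  · rw [perturbation_eq_zero hφ h0 t₀ (Or.inr (Or.inr hp)),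
      perturbationDeriv_eq_zero hφ h0 t₀ (Or.inr (Or.inr hp))]
    ring
  · have h1 : |z.2.2 / R| < 1 := by
      rw [abs_div, abs_of_pos hR0, div_lt_one hR0]; linarith
    rw [cutoffDeriv, hφ.deriv_eq_zero_of_abs_lt h1, hφ.eq_one _ h1.le]
    ring

theorem exists_integral_indexDensity_neg (hW : ContDiff ℝ 2 fun z : ℝ × ℝ => W z.1 z.2)
    (hφ : IsPlateau φ) (h0 : ∀ u t, U < |u| ∨ T < t → W u t = 0) {C : ℝ}
    (hC : ∀ u t, |partialUU W u t| ≤ C) {u₀ t₀ : ℝ} (hne : partialU W u₀ t₀ ≠ 0) :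
    ∃ R ε : ℝ, Integrable (indexDensity W φ t₀ R ε) ∧
      ∫ z, indexDensity W φ t₀ R ε z < 0 := by
  set c₁ := (∫ t, ∫ u, force W t u ^ 2) * ∫ p, deriv φ p ^ 2 with hc₁
  set c₂ := ∫ z : ℝ × ℝ × ℝ, curvature W z.1 z.2.1 * perturbation W φ t₀ z with hc₂
  set c₃ := ∫ z : ℝ × ℝ × ℝ, (perturbationDeriv W φ t₀ z ^ 2 -
    curvature W z.1 z.2.1 * perturbation W φ t₀ z ^ 2) with hc₃
  have hpos : 0 < c₂ := integral_curvature_mul_perturbation_pos hW hφ h0 hne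
  have hψc := continuous_perturbation hW hφ t₀
  have hDc := continuous_perturbationDeriv hW hφ t₀
  have hKc := (continuous_curvature hW).comp_time_position
  have hi₃ : Integrable fun z : ℝ × ℝ × ℝ => perturbationDeriv W φ t₀ z ^ 2 -
      curvature W z.1 z.2.1 * perturbation W φ t₀ z ^ 2 := by
    refine Continuous.integrable_of_hasCompactSupport (by fun_prop)
      (hasCompactSupport_of_box (t₀ := t₀) (U := U) fun z hz => ?_)
    rw [perturbation_eq_zero hφ h0 t₀ hz, perturbationDeriv_eq_zero hφ h0 t₀ hz]
    ring
  have hi₂ := integrable_curvature_mul_perturbation hW hφ h0 t₀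
  have hval : ∀ R ε : ℝ, 2 ≤ R → Integrable (indexDensity W φ t₀ R ε) ∧
      ∫ z, indexDensity W φ t₀ R ε z = c₁ / R + ε ^ 2 * c₃ - 2 * ε * c₂ := by
    intro R ε hR
    have hR0 : 0 < R := by linarith
    have hA := integrable_cutoffDeriv_sq hW hφ h0 hC hR0
    have hK := integrable_curvature_mul_cutoff_sq hW hφ h0 hC hR0
    rw [show indexDensity W φ t₀ R ε = _ from funext (indexDensity_eq hφ h0 t₀ ε hR)]
    have h1 : Integrable fun z : ℝ × ℝ × ℝ => cutoffDeriv W φ R z ^ 2 +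
        ε ^ 2 * (perturbationDeriv W φ t₀ z ^ 2 -
          curvature W z.1 z.2.1 * perturbation W φ t₀ z ^ 2) := hA.add (hi₃.const_mul _)
    have h2 : Integrable fun z : ℝ × ℝ × ℝ => cutoffDeriv W φ R z ^ 2 +
        ε ^ 2 * (perturbationDeriv W φ t₀ z ^ 2 -
          curvature W z.1 z.2.1 * perturbation W φ t₀ z ^ 2) -
        curvature W z.1 z.2.1 * φ (z.2.2 / R) ^ 2 := h1.sub hK
    refine ⟨h2.sub (hi₂.const_mul _), ?_⟩
    beta_reduce
    rw [integral_sub h2 (hi₂.const_mul _), integral_sub h1 hK, integral_add hA (hi₃.const_mul _),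
      integral_const_mul, integral_const_mul, integral_cutoffDeriv_sq hW hφ h0 hC hR0,
      integral_curvature_mul_cutoff_sq hW hφ h0 hC hR0]
    ring
  -- The averaged form is `c₁ / R + ε ^ 2 * c₃ - 2 * ε * c₂`. This `ε` lets one copy of `ε * c₂`
  -- absorb the quadratic term; `R` is then taken so large that `c₁ / R` is below the other copy.
  set ε := c₂ / (|c₃| + 1) with hε
  have hε0 : 0 < ε := by positivity
  have hε1 : ε ^ 2 * c₃ ≤ ε * c₂ := by
    have h1 : ε * (|c₃| + 1) = c₂ := by rw [hε]; field_simp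
    have h2 : c₃ ≤ |c₃| + 1 := by linarith [le_abs_self c₃]
    calc ε ^ 2 * c₃ ≤ ε ^ 2 * (|c₃| + 1) := mul_le_mul_of_nonneg_left h2 (sq_nonneg _)
      _ = ε * c₂ := by rw [← h1]; ring
  set R := max 2 (|c₁| / (ε * c₂) + 1) with hR
  have hR2 : 2 ≤ R := le_max_left _ _
  obtain ⟨h1, h2⟩ := hval R ε hR2
  refine ⟨R, ε, h1, ?_⟩
  have h3 : c₁ / R < ε * c₂ := by
    have h4 : |c₁| / (ε * c₂) < R := lt_of_lt_of_le (lt_add_one _) (le_max_right _ _)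
    rw [div_lt_iff₀ (by positivity)] at h4
    rw [div_lt_iff₀ (by linarith)]
    linarith [le_abs_self c₁]
  rw [h2]
  linarith

theorem integral_indexDensity_nonneg_of_isDisconjugate
    (hW : ContDiff ℝ 2 fun z : ℝ × ℝ => W z.1 z.2)
    (hφ : IsPlateau φ) (h0 : ∀ u t, U < |u| ∨ T < t → W u t = 0) {C : ℝ}
    (hC : ∀ u t, |partialUU W u t| ≤ C) (t₀ ε : ℝ) {R : ℝ} {u p : ℝ → ℝ}
    (hu : ∀ t, HasDerivAt u (p t) t) (hp : ∀ t, HasDerivAt p (force W t (u t)) t)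
    (hdis : IsDisconjugate fun t => curvature W t (u t)) :
    0 ≤ ∫ t, indexDensity W φ t₀ R ε (t, u t, p t) := by
  have huc : Continuous u := continuous_iff_continuousAt.2 fun t => (hu t).continuousAt
  have hpc : Continuous p := continuous_iff_continuousAt.2 fun t => (hp t).continuousAt
  have hγ : Continuous fun t => (t, u t, p t) := by fun_prop
  obtain ⟨c, hc, hK⟩ := exists_curvature_bound h0 hC
  obtain ⟨c', hc', hF⟩ := exists_force_bound hW h0 hC
  have hDc := continuous_perturbationDeriv hW hφ t₀
  obtain ⟨B, hB⟩ := (hasCompactSupport_perturbation hφ h0 t₀).exists_bound_of_continuous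
    (continuous_perturbation hW hφ t₀)
  obtain ⟨B', hB', hD⟩ := (hasCompactSupport_perturbationDeriv hφ h0 t₀
    ).exists_inv_one_add_sq_bound hDc
  obtain ⟨D, hDφ⟩ := (HasCompactSupport.intro (isCompact_Icc (a := (-2 : ℝ)) (b := 2))
    (f := deriv φ) fun x hx => hφ.deriv_eq_zero_of_lt_abs (not_le.1 fun h => hx (abs_le.1 h))
    ).exists_bound_of_continuous hφ.continuous_deriv
  have hKc : Continuous fun t => curvature W t (u t) :=
    (continuous_curvature hW).comp (continuous_id.prodMk huc)
  have hKb : ∀ t, |curvature W t (u t)| ≤ c := fun t => (hK t (u t)).trans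
    (mul_le_of_le_one_right hc (inv_le_one_of_one_le₀ (by nlinarith [sq_nonneg t])))
  have hder := fun t => hasDerivAt_testFunction (hW.differentiable two_ne_zero) hφ t₀ R ε
    (hu t) (hp t)
  have hH : ∀ t, |φ (p t / R) + ε * perturbation W φ t₀ (t, u t, p t)| ≤ 1 + |ε| * B := fun t => by
    refine (abs_add_le _ _).trans (add_le_add ?_ ?_)
    · rw [abs_of_nonneg (hφ.nonneg _)]; exact hφ.le_one _
    · rw [abs_mul]; exact mul_le_mul_of_nonneg_left (hB _) (abs_nonneg _)
  have hH' : Continuous fun t => cutoffDeriv W φ R (t, u t, p t) +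
      ε * perturbationDeriv W φ t₀ (t, u t, p t) :=
    ((continuous_cutoffDeriv hW hφ R).comp hγ).add (continuous_const.mul (hDc.comp hγ))
  have hHc : Continuous fun t => φ (p t / R) + ε * perturbation W φ t₀ (t, u t, p t) :=
    continuous_iff_continuousAt.2 fun t => (hder t).continuousAt
  refine hdis.integral_univ_nonneg hKc hKb hder hH' hH ?_ ?_
  · set A := c' * |D / R| + |ε| * B' with hA
    refine (integrable_inv_one_add_sq.const_mul (A ^ 2)).mono' (hH'.pow 2).aestronglyMeasurable
      (Eventually.of_forall fun t => ?_)
    have h1 : |cutoffDeriv W φ R (t, u t, p t) + ε * perturbationDeriv W φ t₀ (t, u t, p t)| ≤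
        A * (1 + t ^ 2)⁻¹ := by
      rw [hA, add_mul]
      refine (abs_add_le _ _).trans (add_le_add ?_ ?_)
      · rw [cutoffDeriv, abs_mul, mul_right_comm]
        refine mul_le_mul (hF t (u t)) ?_ (abs_nonneg _) (by positivity)
        rw [abs_div, abs_div]
        exact div_le_div_of_nonneg_right ((hDφ _).trans (le_abs_self D)) (abs_nonneg R)
      · rw [abs_mul, mul_assoc]
        exact mul_le_mul_of_nonneg_left (hD _ _ _) (abs_nonneg ε)
    rw [Real.norm_of_nonneg (sq_nonneg _), ← sq_abs]
    refine (pow_le_pow_left₀ (abs_nonneg _) h1 2).trans ?_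
    rw [mul_pow]
    exact mul_le_mul_of_nonneg_left (inv_one_add_sq_sq_le t) (sq_nonneg A)
  · refine (integrable_inv_one_add_sq.const_mul (c * (1 + |ε| * B) ^ 2)).mono'
      (hKc.mul (hHc.pow 2)).aestronglyMeasurable (Eventually.of_forall fun t => ?_)
    rw [Real.norm_eq_abs, abs_mul, abs_of_nonneg (a := (_ : ℝ) ^ 2) (sq_nonneg _), mul_right_comm]
    refine mul_le_mul (hK t (u t)) ?_ (sq_nonneg _) (by positivity)
    rw [← sq_abs]
    exact pow_le_pow_left₀ (abs_nonneg _) (hH t) 2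

theorem hasConjugatePoints_of_not_isDisconjugate {u : ℝ → ℝ}
    (h : ¬ IsDisconjugate fun t => curvature W t (u t)) : HasConjugatePoints W u := by
  unfold IsDisconjugate at h
  push Not at h
  obtain ⟨ξ, η, hsol, hne, t₁, t₂, hlt, h1, h2⟩ := h
  refine ⟨t₁, t₂, hlt, ξ, ⟨η, fun t => ⟨(hsol t).1, (hsol t).2.congr_deriv ?_⟩⟩, hne, h1, h2⟩
  simp only [curvature]
  ring

/-- A potential constant in `u` at each time is zero, since it vanishes for large `|u|`. -/
theorem exists_partialU_ne_zero (hW : Differentiable ℝ fun z : ℝ × ℝ => W z.1 z.2)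
    (h0 : ∀ u t, U < |u| ∨ T < t → W u t = 0) (hne : ∃ u t, W u t ≠ 0) :
    ∃ u t, partialU W u t ≠ 0 := by
  by_contra! hcon
  obtain ⟨u, t, hut⟩ := hne
  refine hut ?_
  have h1 := is_const_of_deriv_eq_zero
    (fun x => (hasDerivAt_partialU hW x t).differentiableAt) (fun x => hcon x t) u (|U| + 1)
  refine h1.trans (h0 _ _ (Or.inl ?_))
  rw [abs_of_nonneg (by positivity)]
  linarith [le_abs_self U]

end Main

theorem theorem4 (W : ℝ → ℝ → ℝ)
    (hW : ContDiff ℝ 2 (fun x : ℝ × ℝ => W x.1 x.2))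
    (U T : ℝ) (hsupp : ∀ u t : ℝ, W u t ≠ 0 → |u| ≤ U ∧ t ≤ T)
    (hbdd : ∃ C : ℝ, ∀ u t : ℝ, |partialUU W u t| ≤ C)
    (hne : ∃ u t : ℝ, W u t ≠ 0) :
    ∃ u p : ℝ → ℝ, IsNewtonSolution W u p ∧ HasConjugatePoints W u := by
  obtain ⟨C, hC⟩ := hbdd
  have h0 : ∀ u t, U < |u| ∨ T < t → W u t = 0 := fun u t h => by
    by_contra hut
    obtain ⟨h1, h2⟩ := hsupp u t hut
    rcases h with h | h <;> linarith
  obtain ⟨u₀, t₀, hne'⟩ := exists_partialU_ne_zero (hW.differentiable two_ne_zero) h0 hne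
  obtain ⟨φ, hφ⟩ := exists_isPlateau
  obtain ⟨R, ε, hint, hneg⟩ := exists_integral_indexDensity_neg hW hφ h0 hC hne'
  obtain ⟨c, hc, hK⟩ := exists_curvature_bound h0 hC
  obtain ⟨c', hc', hF⟩ := exists_force_bound hW h0 hC
  have hinv : ∀ t : ℝ, 0 ≤ (1 + t ^ 2)⁻¹ := fun t => by positivity
  obtain ⟨X, hXc, hXm, hX⟩ := exists_newtonFlow (A := ⟨max c c', hc.trans (le_max_left _ _)⟩)
    (continuous_force hW)
    (fun t u => (hF t u).trans (mul_le_mul_of_nonneg_right (le_max_right _ _) (hinv t)))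
    (fun t u u' => (abs_force_sub_le hW hK t u u').trans (mul_le_mul_of_nonneg_right
      (mul_le_mul_of_nonneg_right (le_max_left _ _) (hinv t)) (abs_nonneg _)))
  obtain ⟨y, hy⟩ := exists_integral_neg_of_measurePreserving hXc.measurable hXm hint hneg
  refine ⟨fun t => (X (t, y)).1, fun t => (X (t, y)).2, hX y,
    hasConjugatePoints_of_not_isDisconjugate fun hdis => hy.not_ge ?_⟩
  exact integral_indexDensity_nonneg_of_isDisconjugate hW hφ h0 hC t₀ ε
    (fun t => (hX y t).1) (fun t => (hX y t).2) hdis
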